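/- Let $\lambda=(\lambda_1,\dots,\lambda_r)$ and $\mu=(\mu_1,\dots,\mu_s)$ be compositions of $n\ge 0$ (finite sequences of positive integers with sum $n$). Write $\frac{\lambda}{\mu}$ for the meander on $n$ nodes with upper composition $\lambda$ and lower composition $\mu$; distinct pairs $(\lambda,\mu)$ count as distinct meanders. The associated seaweed algebra is the Lie subalgebra of $\mathfrak{gl}_n(\mathbb C)$ consisting of the matrices whose nonzero entries on or above the diagonal lie in the consecutive diagonal blocks of sizes $\lambda_1,\dots,\lambda_r$ and whose nonzero entries on or below the diagonal lie in the consecutive diagonal blocks of sizes $\mu_1,\dots,\mu_s$. The index of $\frac{\lambda}{\mu}$ is the index of this Lie algebra $\mathfrak g$, that is, $\min_{f\in\mathfrak g^*}\dim\{x\in\mathfrak g : f([x,y])=0 \text{ for all } y\in\mathfrak g\}$. For a set $J$ of positive integers let $a^J_{n,k}$ be the number of meanders on $n$ nodes with index $k$ such that all parts of $\lambda$ and of $\mu$ belong to $J$, and let $A_J(x,y)=\sum_{n,k\ge 0}a^J_{n,k}x^ny^k$. A meander on $n\ge 1$ nodes is indecomposable if it is not of the form $\frac{\lambda'|\lambda''}{\mu'|\mu''}$,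 where $|$ denotes concatenation and $\frac{\lambda'}{\mu'}$, $\frac{\lambda''}{\mu''}$ are meanders on fewer than $n$ nodes. Let $i_{n,k}$ be the number of indecomposable meanders on $n$ nodes with index $k$ and all parts in $\{1,2,3\}$, with $i_{n,k}=0$ for $k<0$. **Theorem.** As formal power series, $$A_{\{1,2,3\}}(x,y)=\frac{1-x-x^2y-x^3y}{(1-x-x^2y-x^3y)(1-xy-x^2y^2-x^3y^3)-(2x^2y+4x^3y+2x^3y^2+2x^4y^2+2x^5y)}.$$ Moreover, for all $n>6$ and $k\ge 0$, $$i_{n,k}=i_{n-1,k}+i_{n-2,k-1}+i_{n-3,k-1},$$ and for every integer $c\ge 1$, $$A_{\{c,2c,3c\}}(x,y)=A_{\{1,2,3\}}(x^c,y^c).$$ -/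

import Mathlib

noncomputable section

namespace SeaweedMeander

attribute [local instance 100] LieRing.ofAssociativeRing

/-- The stabilizer `L_f = {x | f ⁅x, y⁆ = 0 for all y}` of a linear form `f` on a Lie algebra `L`
under the coadjoint action. -/
def coadjointStabilizer {K L : Type*} [Field K] [LieRing L] [LieAlgebra K L]
    (f : Module.Dual K L) : Submodule K L where
  carrier := {x | ∀ y : L, f ⁅x, y⁆ = 0}
  zero_mem' := by
    intro y
    simp
  add_mem' := by
    intro a b ha hb y
    rw [add_lie, map_add, ha y, hb y, add_zero]
  smul_mem' := by
    intro c a ha y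
    rw [smul_lie, map_smul, ha y, smul_zero]

/-- The index of a (finite-dimensional) Lie algebra: the minimal dimension of the stabilizer of a
linear form under the coadjoint action. -/
def lieIndex (K L : Type*) [Field K] [LieRing L] [LieAlgebra K L] : ℕ :=
  ⨅ f : Module.Dual K L, Module.finrank K (coadjointStabilizer f)

/-- A meander `λ/μ` with `n` nodes, recorded by its upper composition `λ` and its lower
composition `μ`, both compositions of `n`. -/
@[ext]
structure Meander (n : ℕ) where
  /-- The upper composition `λ`. -/
  top : Composition n
  /-- The lower composition `μ`. -/
  bot : Composition n

/-- The block containing a position is a monotone function of the position. -/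
theorem index_mono {n : ℕ} (c : Composition n) {i j : Fin n} (h : i ≤ j) :
    c.index i ≤ c.index j := by
  by_contra! hlt
  have h1 := c.lt_sizeUpTo_index_succ j
  have h2 := c.sizeUpTo_index_le i
  have h3 : c.sizeUpTo (c.index j).succ ≤ c.sizeUpTo (c.index i) :=
    c.monotone_sizeUpTo (by simpa using hlt)
  have h4 : (i : ℕ) ≤ j := h
  omega

/-- A position between two positions of one block lies in that block. -/
theorem index_eq_of_between {n : ℕ} (c : Composition n) {i k j : Fin n} (hik : i ≤ k) (hkj : k ≤ j)
    (h : c.index i = c.index j) : c.index i = c.index k ∧ c.index k = c.index j := by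
  have h1 := index_mono c hik
  have h2 := index_mono c hkj
  exact ⟨le_antisymm h1 (h ▸ h2), le_antisymm h2 (h ▸ h1)⟩

/-- `A` has the shape of the seaweed of `M`: every nonzero entry on or above the diagonal lies in a
diagonal block of the upper composition, and every nonzero entry on or below the diagonal lies in a
diagonal block of the lower composition. -/
def HasShape {K : Type*} [Field K] {n : ℕ} (M : Meander n) (A : Matrix (Fin n) (Fin n) K) : Prop :=
  ∀ i j, A i j ≠ 0 →
    (i ≤ j → M.top.index i = M.top.index j) ∧ (j ≤ i → M.bot.index i = M.bot.index j)

/-- Matrices of seaweed shape are closed under multiplication. -/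
theorem HasShape.mul {K : Type*} [Field K] {n : ℕ} {M : Meander n}
    {A B : Matrix (Fin n) (Fin n) K} (hA : HasShape M A) (hB : HasShape M B) :
    HasShape M (A * B) := by
  intro i j hij
  rw [Matrix.mul_apply] at hij
  obtain ⟨k, -, hk⟩ := Finset.exists_ne_zero_of_sum_ne_zero hij
  have a := hA i k (left_ne_zero_of_mul hk)
  have b := hB k j (right_ne_zero_of_mul hk)
  constructor
  · intro h
    rcases le_total i k with h1 | h1
    · rcases le_total k j with h2 | h2
      · exact (a.1 h1).trans (b.1 h2)
      · exact (index_eq_of_between _ h h2 (a.1 h1)).1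
    · exact (index_eq_of_between _ h1 h (b.1 (h1.trans h))).2
  · intro h
    rcases le_total k i with h1 | h1
    · rcases le_total j k with h2 | h2
      · exact (a.2 h1).trans (b.2 h2)
      · exact (index_eq_of_between _ h2 h (a.2 h1).symm).2.symm
    · exact (index_eq_of_between _ h h1 (b.2 (h.trans h1)).symm).1.symm

theorem HasShape.sub {K : Type*} [Field K] {n : ℕ} {M : Meander n}
    {A B : Matrix (Fin n) (Fin n) K} (hA : HasShape M A) (hB : HasShape M B) :
    HasShape M (A - B) := by
  intro i j hij
  by_cases h : A i j = 0
  · refine hB i j fun h' => hij ?_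
    simp [h, h']
  · exact hA i j h

/-- The seaweed algebra of the meander `M`, a Lie subalgebra of `𝔤𝔩ₙ(K)`. -/
def seaweed (K : Type*) [Field K] {n : ℕ} (M : Meander n) :
    LieSubalgebra K (Matrix (Fin n) (Fin n) K) where
  carrier := {A | HasShape M A}
  zero_mem' := by
    intro i j h
    simp at h
  add_mem' := by
    intro A B hA hB i j hij
    by_cases h : A i j = 0
    · refine hB i j fun h' => hij ?_
      simp [h, h']
    · exact hA i j h
  smul_mem' := by
    intro c A hA i j hij
    exact hA i j fun h => hij (by simp [h])
  lie_mem' := by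
    intro A B hA hB
    rw [Ring.lie_def]
    exact (HasShape.mul hA hB).sub (HasShape.mul hB hA)

/-- The index of a meander: the index of its complex seaweed algebra. -/
def Meander.index {n : ℕ} (M : Meander n) : ℕ :=
  lieIndex ℂ (seaweed ℂ M)

/-- All parts of both compositions of `M` belong to `J`. -/
def Meander.PartsIn {n : ℕ} (M : Meander n) (J : Set ℕ) : Prop :=
  (∀ p ∈ M.top.blocks, p ∈ J) ∧ (∀ p ∈ M.bot.blocks, p ∈ J)

/-- `M` is the direct sum of `M₁` and `M₂`: its compositions are the concatenations of theirs. -/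
def Meander.IsDirectSum {n m₁ m₂ : ℕ} (M : Meander n) (M₁ : Meander m₁) (M₂ : Meander m₂) : Prop :=
  M.top.blocks = M₁.top.blocks ++ M₂.top.blocks ∧ M.bot.blocks = M₁.bot.blocks ++ M₂.bot.blocks

/-- A nonempty meander is indecomposable if it is not the direct sum of two strictly smaller
meanders. -/
def Meander.Indecomposable {n : ℕ} (M : Meander n) : Prop :=
  0 < n ∧ ¬ ∃ (m₁ m₂ : ℕ) (M₁ : Meander m₁) (M₂ : Meander m₂),
    m₁ < n ∧ m₂ < n ∧ M.IsDirectSum M₁ M₂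

/-- `a^J_{n,k}`: the number of meanders with `n` nodes, parts in `J` and index `k`. -/
def meanderCount (J : Set ℕ) (n k : ℕ) : ℕ :=
  {M : Meander n | M.PartsIn J ∧ M.index = k}.ncard

/-- `i^J_{n,k}`: the number of indecomposable meanders with `n` nodes, parts in `J` and index
`k`. -/
def indecomposableCount (J : Set ℕ) (n k : ℕ) : ℕ :=
  {M : Meander n | M.PartsIn J ∧ M.Indecomposable ∧ M.index = k}.ncard

/-- The generating function `A_J(x, y) = ∑ a^J_{n,k} xⁿ yᵏ`, with `x` and `y` the variables of
index `0` and `1`. -/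
def meanderSeries (J : Set ℕ) : MvPowerSeries (Fin 2) ℚ :=
  fun e => (meanderCount J (e 0) (e 1) : ℚ)

end SeaweedMeander

end

/-! For a linear form `f`, the stabilizer is the radical of the form `(x, y) ↦ f (xy - yx)`, so the
index is the least dimension of such a radical. A seaweed algebra is the space of matrices supported
on a transitive relation, and its index is computed recursively.

Three facts carry the recursion. The index is additive under concatenation (`listIndex_append`). The
full matrix algebra of size `a` has index `a` (`relIndex_full`): for generic `M` the stabilizer of
`x ↦ trace (M x)` is the centralizer of a matrix with a cyclic vector. Finally, Panyushev's
reduction (`listIndex_reduce`) replaces a meander whose first blocks `a < b` differ by a smaller one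
of the same index. The lower left part of the seaweed algebra, with columns in the first upper block
and rows beyond it, is an abelian ideal. A generic form is conjugate to one that is standard on this
ideal, and a coisotropic reduction (`finrank_radOn_isotropic`) leaves exactly the smaller seaweed.
Genericity costs nothing, because the stabilizer dimension is upper semicontinuous along lines and
the field is infinite.

With parts in `{1, 2, 3}`, additivity and the reduction only ever produce the beginnings `∅/∅`,
`∅/1` and `∅/1|1`. If `A`, `B`, `C` are the generating functions of the meanders with these
beginnings, then `A = 1 + (1 + x + 2x²) B + x C + (x²y² + x³y³) A`, `B = xy A + x B + x C`, `C = x²y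
A + (xy + x²y) B`, and elimination of `B` and `C` gives the formula (`prefixSeries_equation`).

Every nonempty meander has a unique indecomposable first summand, so `A = 1 + I A` for the series
`I` of the indecomposables. Hence `I` is a fraction with denominator `1 - x - x²y - x³y` and a
numerator of degree 6 in `x`, which is the recurrence beyond 6. The scaling statement holds because
the recursive rules are homogeneous in the block sizes (`listIndex_map_mul`). -/

noncomputable section

namespace SeaweedMeander

open Module

/-! ### Radicals of bilinear forms on subspaces -/

section Radical

variable {K E E' : Type*} [Field K] [AddCommGroup E] [Module K E] [AddCommGroup E'] [Module K E']

/-- The radical of the restriction of a bilinear form to a subspace. -/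
def radOn (B : E →ₗ[K] E →ₗ[K] K) (G : Submodule K E) : Submodule K E where
  carrier := {x | x ∈ G ∧ ∀ y ∈ G, B x y = 0}
  zero_mem' := by simp
  add_mem' := by
    rintro a b ⟨ha, ha'⟩ ⟨hb, hb'⟩
    exact ⟨G.add_mem ha hb, fun y hy => by simp [ha' y hy, hb' y hy]⟩
  smul_mem' := by
    rintro c a ⟨ha, ha'⟩
    exact ⟨G.smul_mem c ha, fun y hy => by simp [ha' y hy]⟩

theorem mem_radOn {B : E →ₗ[K] E →ₗ[K] K} {G : Submodule K E} {x : E} :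
    x ∈ radOn B G ↔ x ∈ G ∧ ∀ y ∈ G, B x y = 0 := Iff.rfl

theorem finrank_eq_of_map_eq {p : Submodule K E} {q : Submodule K E'} (σ : E →ₗ[K] E')
    (hσ : ∀ x ∈ p, σ x = 0 → x = 0) (h : p.map σ = q) : finrank K p = finrank K q := by
  have hinj : Function.Injective (σ.domRestrict p) := by
    rw [← LinearMap.ker_eq_bot, LinearMap.ker_eq_bot']
    rintro ⟨x, hx⟩ h0
    exact Subtype.ext (hσ x hx h0)
  rw [← LinearMap.finrank_range_of_inj hinj, ← h, LinearMap.range_domRestrict]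

/-- The dimension of the radical is unchanged under an isometric isomorphism of subspaces. -/
theorem finrank_radOn_transport {B : E →ₗ[K] E →ₗ[K] K} {B' : E' →ₗ[K] E' →ₗ[K] K}
    {G : Submodule K E} {G' : Submodule K E'} (σ : E →ₗ[K] E')
    (hσ : ∀ x ∈ G, σ x = 0 → x = 0) (hG : G.map σ = G')
    (hB : ∀ x ∈ G, ∀ y ∈ G, B' (σ x) (σ y) = B x y) :
    finrank K (radOn B G) = finrank K (radOn B' G') := by
  refine finrank_eq_of_map_eq σ (fun x hx => hσ x hx.1) ?_
  subst hG
  ext z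
  constructor
  · rintro ⟨x, ⟨hx, hx'⟩, rfl⟩
    refine ⟨⟨x, hx, rfl⟩, ?_⟩
    rintro _ ⟨y, hy, rfl⟩
    rw [hB x hx y hy, hx' y hy]
  · rintro ⟨⟨x, hx, rfl⟩, hz⟩
    exact ⟨x, ⟨hx, fun y hy => by rw [← hB x hx y hy, hz _ ⟨y, hy, rfl⟩]⟩, rfl⟩

/-- Reduction of an antisymmetric form by an isotropic subspace `V` that meets the radical
trivially: the radical has the same dimension as that of the part `C` of a complement `S` of `V`
orthogonal to `V`. -/
theorem finrank_radOn_isotropic [FiniteDimensional K E] {B : E →ₗ[K] E →ₗ[K] K}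
    (hB : ∀ x y, B x y = - B y x) {G S V C : Submodule K E} (hG : G = S ⊔ V) (π : E →ₗ[K] E)
    (hπS : ∀ s ∈ S, π s = s) (hπV : ∀ v ∈ V, π v = 0) (hV : ∀ v ∈ V, ∀ w ∈ V, B v w = 0)
    (hVS : ∀ v ∈ V, (∀ s ∈ S, B v s = 0) → v = 0)
    (hC : ∀ s, s ∈ C ↔ s ∈ S ∧ ∀ v ∈ V, B s v = 0) :
    finrank K (radOn B G) = finrank K (radOn B C) := by
  refine finrank_eq_of_map_eq π ?_ ?_
  · rintro x ⟨hx, hx'⟩ h0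
    rw [hG] at hx
    obtain ⟨s, hs, v, hv, rfl⟩ := Submodule.mem_sup.1 hx
    rw [map_add, hπS s hs, hπV v hv, add_zero] at h0
    subst h0
    rw [zero_add] at hx' ⊢
    exact hVS v hv fun s hs => hx' s (hG ▸ Submodule.mem_sup_left hs)
  · ext x
    constructor
    · rintro ⟨z, ⟨hz, hz'⟩, rfl⟩
      rw [hG] at hz
      obtain ⟨s, hs, v, hv, rfl⟩ := Submodule.mem_sup.1 hz
      rw [map_add, hπS s hs, hπV v hv, add_zero]
      have hsV : ∀ w ∈ V, B s w = 0 := fun w hw => by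
        have := hz' w (hG ▸ Submodule.mem_sup_right hw)
        rwa [map_add, LinearMap.add_apply, hV v hv w hw, add_zero] at this
      refine ⟨(hC s).2 ⟨hs, hsV⟩, fun y hy => ?_⟩
      have hy' := (hC y).1 hy
      have := hz' y (hG ▸ Submodule.mem_sup_left hy'.1)
      rwa [map_add, LinearMap.add_apply, hB v y, hy'.2 v hv, neg_zero, add_zero] at this
    · rintro ⟨hx, hx'⟩
      obtain ⟨hxS, hxV⟩ := (hC x).1 hx
      -- The kernel of `φ` is `C`, on which `B x` vanishes. Hence `-B x` on `S` lies in the range of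
      -- the dual map of `φ`, and since `V` is its own bidual it is represented by some `v ∈ V`. The
      -- corrected vector `x - v` is then in the radical.
      let φ : S →ₗ[K] Dual K V := (B.domRestrict₁₂ S V)
      have hmem : (-(B x)).domRestrict S ∈ (LinearMap.ker φ).dualAnnihilator := by
        rw [Submodule.mem_dualAnnihilator]
        rintro ⟨s, hs⟩ hker
        have : s ∈ C := (hC s).2 ⟨hs, fun v hv => LinearMap.congr_fun hker ⟨v, hv⟩⟩
        simp [hx' s this]
      rw [← LinearMap.range_dualMap_eq_dualAnnihilator_ker] at hmem
      obtain ⟨ψ, hψ⟩ := hmem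
      obtain ⟨v, rfl⟩ := (Module.evalEquiv K V).surjective ψ
      have hv : ∀ s ∈ S, B s v = - B x s := fun s hs => LinearMap.congr_fun hψ ⟨s, hs⟩
      refine ⟨x - v, ⟨hG ▸ Submodule.sub_mem _ (Submodule.mem_sup_left hxS)
        (Submodule.mem_sup_right v.2), fun y hy => ?_⟩, ?_⟩
      · rw [hG] at hy
        obtain ⟨s, hs, w, hw, rfl⟩ := Submodule.mem_sup.1 hy
        rw [map_sub, LinearMap.sub_apply, map_add, map_add, hxV w hw, hV v v.2 w hw, hB v s, hv s hs]
        ring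
      · rw [map_sub, hπS x hxS, hπV v v.2, sub_zero]

/-- Lower semicontinuity of the rank along a line. -/
theorem finite_finrank_ker_lt [FiniteDimensional K E] [FiniteDimensional K E']
    (A A' : E →ₗ[K] E') :
    {t : K | finrank K (LinearMap.ker A) < finrank K (LinearMap.ker (A + t • A'))}.Finite := by
  obtain ⟨C, hC⟩ := Submodule.exists_isCompl (LinearMap.ker A)
  have hinj : LinearMap.ker (A.domRestrict C) = ⊥ := by
    rw [LinearMap.ker_eq_bot']
    rintro ⟨x, hx⟩ h0
    exact Subtype.ext (Submodule.disjoint_def.1 hC.disjoint x h0 hx)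
  obtain ⟨L, hL⟩ := LinearMap.exists_leftInverse_of_injective _ hinj
  let N : Module.End K C := L ∘ₗ A'.domRestrict C
  -- A kernel that is too large meets the complement `C` in some `x ≠ 0`. Applying the left inverse
  -- `L` gives `x + t N x = 0`, so `-t⁻¹` is an eigenvalue of `N`.
  refine ((Module.End.finite_spectrum N).image fun μ => - μ⁻¹).subset fun t ht => ?_
  have ht' : ¬ Disjoint (LinearMap.ker (A + t • A')) C := by
    intro hd
    have h1 := Submodule.finrank_add_finrank_le_of_disjoint hd
    have h2 := Submodule.finrank_add_eq_of_isCompl hC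
    have h3 : finrank K (LinearMap.ker A) < finrank K (LinearMap.ker (A + t • A')) := ht
    omega
  rw [Submodule.disjoint_def] at ht'
  push Not at ht'
  obtain ⟨x, hx, hxC, hx0⟩ := ht'
  have e1 : L (A x) = ⟨x, hxC⟩ := LinearMap.congr_fun hL ⟨x, hxC⟩
  have e2 : A x + t • A' x = 0 := hx
  have e3 : (⟨x, hxC⟩ : C) + t • N ⟨x, hxC⟩ = 0 := by
    have := congrArg L e2
    rwa [map_add, e1, map_smul, map_zero] at this
  have ht0 : t ≠ 0 := by
    rintro rfl
    rw [zero_smul, add_zero] at e3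
    exact hx0 (congrArg Subtype.val e3)
  refine ⟨-t⁻¹, ?_, by simp⟩
  apply Module.End.HasEigenvalue.mem_spectrum
  refine Module.End.hasEigenvalue_of_hasEigenvector (x := ⟨x, hxC⟩) ⟨?_, fun h => hx0 (congrArg Subtype.val h)⟩
  rw [Module.End.mem_eigenspace_iff]
  have e4 : t • N ⟨x, hxC⟩ = - ⟨x, hxC⟩ := by rw [eq_neg_iff_add_eq_zero, add_comm]; exact e3
  rw [neg_smul, ← smul_neg, ← e4, smul_smul, inv_mul_cancel₀ ht0, one_smul]

theorem finrank_radOn_eq_ker (B : E →ₗ[K] E →ₗ[K] K) (G : Submodule K E) :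
    finrank K (radOn B G) = finrank K (LinearMap.ker (B.domRestrict₁₂ G G)) := by
  symm
  refine finrank_eq_of_map_eq G.subtype (fun x _ h => Subtype.ext h) ?_
  ext x
  constructor
  · rintro ⟨⟨x, hx⟩, h, rfl⟩
    exact ⟨hx, fun y hy => LinearMap.congr_fun h ⟨y, hy⟩⟩
  · rintro ⟨hx, h⟩
    exact ⟨⟨x, hx⟩, LinearMap.ext fun y => h y y.2, rfl⟩

theorem finite_finrank_radOn_lt [FiniteDimensional K E] (B B' : E →ₗ[K] E →ₗ[K] K)
    (G : Submodule K E) :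
    {t : K | finrank K (radOn B G) < finrank K (radOn (B + t • B') G)}.Finite := by
  convert finite_finrank_ker_lt (B.domRestrict₁₂ G G) (B'.domRestrict₁₂ G G) using 3
  rw [finrank_radOn_eq_ker, finrank_radOn_eq_ker]
  rfl

theorem finrank_radOn_prod {B : E →ₗ[K] E →ₗ[K] K} {B' : E' →ₗ[K] E' →ₗ[K] K}
    {D : E × E' →ₗ[K] E × E' →ₗ[K] K} (hD : ∀ x y, D x y = B x.1 y.1 + B' x.2 y.2)
    (G : Submodule K E) (G' : Submodule K E') [FiniteDimensional K E] [FiniteDimensional K E'] :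
    finrank K (radOn D (G.prod G')) = finrank K (radOn B G) + finrank K (radOn B' G') := by
  have : radOn D (G.prod G') = (radOn B G).prod (radOn B' G') := by
    ext ⟨x, x'⟩
    simp only [Submodule.mem_prod, mem_radOn, hD]
    constructor
    · rintro ⟨⟨h1, h2⟩, h⟩
      exact ⟨⟨h1, fun y hy => by simpa using h (y, 0) ⟨hy, G'.zero_mem⟩⟩,
        h2, fun y hy => by simpa using h (0, y) ⟨G.zero_mem, hy⟩⟩
    · rintro ⟨⟨h1, h2⟩, h3, h4⟩
      exact ⟨⟨h1, h3⟩, fun y hy => by simp [h2 y.1 hy.1, h4 y.2 hy.2]⟩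
  rw [this, ← finrank_prod]
  exact LinearEquiv.finrank_eq
    { toFun := fun x => (⟨x.1.1, x.2.1⟩, ⟨x.1.2, x.2.2⟩)
      invFun := fun x => ⟨(x.1.1, x.2.1), x.1.2, x.2.2⟩
      map_add' := fun _ _ => rfl
      map_smul' := fun _ _ => rfl
      left_inv := fun _ => rfl
      right_inv := fun _ => rfl }

end Radical

end SeaweedMeander

end

noncomputable section

namespace SeaweedMeander

open Module

/-! ### The index of the algebra of matrices supported on a relation -/

section RelIndex

variable {K : Type*} [Field K] {N N' : Type*}

/-- Matrices supported on a relation. -/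
def shape (K : Type*) [Field K] {N : Type*} (r : N → N → Prop) : Submodule K (Matrix N N K) where
  carrier := {A | ∀ i j, A i j ≠ 0 → r i j}
  zero_mem' := by simp
  add_mem' := by
    intro A B hA hB i j hij
    by_cases h : A i j = 0
    · exact hB i j fun h' => hij (by simp [h, h'])
    · exact hA i j h
  smul_mem' := by
    intro c A hA i j hij
    exact hA i j fun h => hij (by simp [h])

theorem mem_shape {r : N → N → Prop} {A : Matrix N N K} :
    A ∈ shape K r ↔ ∀ i j, A i j ≠ 0 → r i j := Iff.rfl

theorem eq_zero_of_mem_shape {r : N → N → Prop} {A : Matrix N N K} (hA : A ∈ shape K r) {i j : N}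
    (h : ¬ r i j) : A i j = 0 := by
  by_contra h'
  exact h (hA i j h')

variable [Fintype N] [DecidableEq N] [Fintype N'] [DecidableEq N']

/-- The bilinear form `(x, y) ↦ f (xy - yx)`. -/
def commForm (f : Dual K (Matrix N N K)) : Matrix N N K →ₗ[K] Matrix N N K →ₗ[K] K :=
  LinearMap.mk₂ K (fun x y => f (x * y - y * x))
    (by intros; rw [← map_add]; congr 1; noncomm_ring)
    (by intros; rw [← map_smul, smul_mul_assoc, mul_smul_comm, smul_sub])
    (by intros; rw [← map_add]; congr 1; noncomm_ring)
    (by intros; rw [← map_smul, smul_mul_assoc, mul_smul_comm, smul_sub])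

@[simp]
theorem commForm_apply (f : Dual K (Matrix N N K)) (x y : Matrix N N K) :
    commForm f x y = f (x * y - y * x) := rfl

theorem commForm_antisymm (f : Dual K (Matrix N N K)) (x y : Matrix N N K) :
    commForm f x y = - commForm f y x := by
  rw [commForm_apply, commForm_apply, ← map_neg, neg_sub]

/-- The dimension of the stabilizer of the linear form `f` in the algebra of matrices supported
on `r`. -/
def stabDim (r : N → N → Prop) (f : Dual K (Matrix N N K)) : ℕ :=
  finrank K (radOn (commForm f) (shape K r))

/-- The index of the algebra of matrices supported on `r`. -/
def relIndex (K : Type*) [Field K] {N : Type*} [Fintype N] [DecidableEq N] (r : N → N → Prop) : ℕ :=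
  ⨅ f : Dual K (Matrix N N K), stabDim r f

theorem exists_stabDim_eq (K : Type*) [Field K] (r : N → N → Prop) :
    ∃ f : Dual K (Matrix N N K), stabDim r f = relIndex K r :=
  ciInf_mem _

theorem relIndex_le (r : N → N → Prop) (f : Dual K (Matrix N N K)) : relIndex K r ≤ stabDim r f :=
  ciInf_le' _ f

theorem le_relIndex {r : N → N → Prop} {d : ℕ} (h : ∀ f : Dual K (Matrix N N K), d ≤ stabDim r f) :
    d ≤ relIndex K r :=
  le_ciInf h

/-- A linear form of minimal stabilizer can be moved in any direction off a finite set of bad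
parameters. -/
theorem exists_stabDim_eq_of_finite [Infinite K] (r : N → N → Prop) (g : Dual K (Matrix N N K))
    (bad : Dual K (Matrix N N K) → Set K) (hbad : ∀ f, (bad f).Finite) :
    ∃ f t, t ∉ bad f ∧ stabDim r (f + t • g) = relIndex K r := by
  obtain ⟨f, hf⟩ := exists_stabDim_eq K r
  obtain ⟨t, ht⟩ := ((hbad f).union
    (finite_finrank_radOn_lt (commForm f) (commForm g) (shape K r))).exists_notMem
  rw [Set.mem_union, not_or] at ht
  refine ⟨f, t, ht.1, le_antisymm ?_ (relIndex_le _ _)⟩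
  rw [← hf]
  exact not_lt.1 ht.2

/-- The scalar `c` makes room for anti-isomorphisms: relabelling uses `c = 1`, transposition uses `c
= -1`. -/
theorem relIndex_le_of_linearEquiv {r : N → N → Prop} {r' : N' → N' → Prop}
    (σ : Matrix N N K ≃ₗ[K] Matrix N' N' K) (c : K)
    (hσ : ∀ A, A ∈ shape K r ↔ σ A ∈ shape K r')
    (hc : ∀ x y, σ x * σ y - σ y * σ x = c • σ (x * y - y * x)) :
    relIndex K r ≤ relIndex K r' := by
  refine le_relIndex fun f => (relIndex_le r (c • f ∘ₗ σ.toLinearMap)).trans_eq ?_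
  refine finrank_radOn_transport σ.toLinearMap (fun x _ h => by simpa using h) ?_ ?_
  · ext z
    constructor
    · rintro ⟨x, hx, rfl⟩
      exact (hσ x).1 hx
    · intro hz
      exact ⟨σ.symm z, (hσ _).2 (by simpa using hz), by simp⟩
  · intro x _ y _
    have := congrArg f (hc x y)
    simpa using this

theorem relIndex_equiv (e : N ≃ N') {r : N → N → Prop} {r' : N' → N' → Prop}
    (h : ∀ i j, r i j ↔ r' (e i) (e j)) : relIndex K r = relIndex K r' := by
  apply le_antisymm
  · refine relIndex_le_of_linearEquiv (Matrix.reindexLinearEquiv K K e e) 1 (fun A => ?_) ?_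
    · constructor
      · intro hA i j hij
        simpa [h] using hA _ _ hij
      · intro hA i j hij
        rw [h]
        exact hA _ _ (by simpa using hij)
    · intro x y
      simp [Matrix.submatrix_mul_equiv]
      rfl
  · refine relIndex_le_of_linearEquiv (Matrix.reindexLinearEquiv K K e.symm e.symm) 1 (fun A => ?_) ?_
    · constructor
      · intro hA i j hij
        rw [h]
        exact hA _ _ (by simpa using hij)
      · intro hA i j hij
        have := hA (e.symm i) (e.symm j) (by simpa using hij)
        simpa [h] using this
    · intro x y
      simp [Matrix.submatrix_mul_equiv]
      rfl

theorem relIndex_flip (r : N → N → Prop) : relIndex K (fun i j => r j i) = relIndex K r := by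
  have key : ∀ r : N → N → Prop, relIndex K (fun i j => r j i) ≤ relIndex K r := fun r => by
    refine relIndex_le_of_linearEquiv (Matrix.transposeLinearEquiv N N K K) (-1) (fun A => ?_) ?_
    · exact ⟨fun hA i j hij => hA j i hij, fun hA i j hij => hA j i hij⟩
    · intro x y
      simp
  exact le_antisymm (key r) (key fun i j => r j i)

theorem relIndex_of_isEmpty [IsEmpty N] (r : N → N → Prop) : relIndex K r = 0 := by
  apply Nat.le_zero.1
  refine (relIndex_le r 0).trans_eq ?_
  exact finrank_zero_of_subsingleton

/-- The index is additive on disjoint unions. -/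
theorem relIndex_sum {r : N ⊕ N' → N ⊕ N' → Prop} {r₁ : N → N → Prop} {r₂ : N' → N' → Prop}
    (h₁ : ∀ i j, r (.inl i) (.inl j) ↔ r₁ i j) (h₂ : ∀ i j, r (.inr i) (.inr j) ↔ r₂ i j)
    (h₁₂ : ∀ i j, ¬ r (.inl i) (.inr j)) (h₂₁ : ∀ i j, ¬ r (.inr i) (.inl j)) :
    relIndex K r = relIndex K r₁ + relIndex K r₂ := by
  let σ₁ : Matrix N N K →ₗ[K] Matrix (N ⊕ N') (N ⊕ N') K :=
    { toFun := fun x => Matrix.fromBlocks x 0 0 0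
      map_add' := by intros; simp [Matrix.fromBlocks_add]
      map_smul' := by intros; simp [Matrix.fromBlocks_smul] }
  let σ₂ : Matrix N' N' K →ₗ[K] Matrix (N ⊕ N') (N ⊕ N') K :=
    { toFun := fun x => Matrix.fromBlocks 0 0 0 x
      map_add' := by intros; simp [Matrix.fromBlocks_add]
      map_smul' := by intros; simp [Matrix.fromBlocks_smul] }
  have key : ∀ f : Dual K (Matrix (N ⊕ N') (N ⊕ N') K),
      stabDim r f = stabDim r₁ (f ∘ₗ σ₁) + stabDim r₂ (f ∘ₗ σ₂) := by
    intro f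
    let D : Matrix N N K × Matrix N' N' K →ₗ[K] Matrix N N K × Matrix N' N' K →ₗ[K] K :=
      (commForm (f ∘ₗ σ₁)).compl₁₂ (LinearMap.fst K _ _) (LinearMap.fst K _ _) +
        (commForm (f ∘ₗ σ₂)).compl₁₂ (LinearMap.snd K _ _) (LinearMap.snd K _ _)
    have hD : ∀ x y, D x y = commForm (f ∘ₗ σ₁) x.1 y.1 + commForm (f ∘ₗ σ₂) x.2 y.2 :=
      fun _ _ => rfl
    rw [stabDim, stabDim, stabDim, ← finrank_radOn_prod hD]
    symm
    refine finrank_radOn_transport (σ₁.coprod σ₂) ?_ ?_ ?_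
    · rintro ⟨x, y⟩ - h
      have h' : Matrix.fromBlocks x 0 0 y = 0 := by
        simpa [σ₁, σ₂, Matrix.fromBlocks_add] using h
      rw [← Matrix.fromBlocks_zero, Matrix.fromBlocks_inj] at h'
      simp [h'.1, h'.2.2.2]
    · ext z
      constructor
      · rintro ⟨⟨x, y⟩, ⟨hx, hy⟩, rfl⟩
        rintro (i | i) (j | j) hij
        · exact (h₁ i j).2 (hx i j (by simpa [σ₁, σ₂] using hij))
        · simp [σ₁, σ₂] at hij
        · simp [σ₁, σ₂] at hij
        · exact (h₂ i j).2 (hy i j (by simpa [σ₁, σ₂] using hij))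
      · intro hz
        refine ⟨(z.toBlocks₁₁, z.toBlocks₂₂), ⟨fun i j hij => (h₁ i j).1 (hz _ _ hij),
          fun i j hij => (h₂ i j).1 (hz _ _ hij)⟩, ?_⟩
        ext (i | i) (j | j)
        · simp [σ₁, σ₂, Matrix.toBlocks₁₁]
        · simp [σ₁, σ₂, eq_zero_of_mem_shape hz (h₁₂ i j)]
        · simp [σ₁, σ₂, eq_zero_of_mem_shape hz (h₂₁ i j)]
        · simp [σ₁, σ₂, Matrix.toBlocks₂₂]
    · rintro ⟨x, x'⟩ - ⟨y, y'⟩ -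
      rw [hD]
      simp only [commForm_apply, LinearMap.comp_apply, ← map_add]
      congr 1
      simp [σ₁, σ₂, Matrix.fromBlocks_multiply, Matrix.fromBlocks_add, sub_eq_add_neg,
        Matrix.fromBlocks_neg]
  apply le_antisymm
  · obtain ⟨f₁, hf₁⟩ := exists_stabDim_eq K r₁
    obtain ⟨f₂, hf₂⟩ := exists_stabDim_eq K r₂
    let π₁ : Matrix (N ⊕ N') (N ⊕ N') K →ₗ[K] Matrix N N K :=
      { toFun := fun x => x.toBlocks₁₁, map_add' := fun _ _ => rfl, map_smul' := fun _ _ => rfl }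
    let π₂ : Matrix (N ⊕ N') (N ⊕ N') K →ₗ[K] Matrix N' N' K :=
      { toFun := fun x => x.toBlocks₂₂, map_add' := fun _ _ => rfl, map_smul' := fun _ _ => rfl }
    refine (relIndex_le r (f₁ ∘ₗ π₁ + f₂ ∘ₗ π₂)).trans_eq ?_
    rw [key, ← hf₁, ← hf₂]
    congr 2
    · ext x : 1
      have h1 : π₁ (σ₁ x) = x := rfl
      have h2 : π₂ (σ₁ x) = 0 := rfl
      simp [h1, h2]
    · ext x : 1
      have h1 : π₁ (σ₂ x) = 0 := rfl
      have h2 : π₂ (σ₂ x) = x := rfl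
      simp [h1, h2]
  · refine le_relIndex fun f => ?_
    rw [key]
    exact add_le_add (relIndex_le _ _) (relIndex_le _ _)

end RelIndex

end SeaweedMeander

end

noncomputable section

namespace SeaweedMeander

open Module Polynomial

/-! ### The index of a full matrix algebra -/

section Full

variable {K : Type*} [Field K] {a : ℕ}

/-- The matrix with columns `M ^ k *ᵥ 1`. -/
def krylov {R : Type*} [CommRing R] {a : ℕ} (M : Matrix (Fin a) (Fin a) R) :
    Matrix (Fin a) (Fin a) R :=
  Matrix.of fun i k => (M ^ (k : ℕ)).mulVec 1 i

theorem krylov_diagonal {R : Type*} [CommRing R] (d : Fin a → R) :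
    krylov (Matrix.diagonal d) = Matrix.vandermonde d := by
  ext i k
  simp [krylov, Matrix.diagonal_pow, Matrix.mulVec_diagonal, Matrix.vandermonde_apply]

theorem map_det_krylov {R S : Type*} [CommRing R] [CommRing S] (φ : R →+* S)
    (M : Matrix (Fin a) (Fin a) R) : φ (krylov M).det = (krylov (M.map φ)).det := by
  rw [RingHom.map_det]
  congr 1
  ext i k
  simp only [RingHom.mapMatrix_apply, Matrix.map_apply, krylov, Matrix.of_apply]
  have : (M.map φ) ^ (k : ℕ) = (M ^ (k : ℕ)).map φ := by
    rw [← RingHom.mapMatrix_apply, ← map_pow, RingHom.mapMatrix_apply]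
  rw [this]
  simp [Matrix.mulVec, dotProduct]

/-- Scaling `M` by `t` multiplies the column of index `k` by `t ^ k`. -/
theorem det_krylov_smul {R : Type*} [CommRing R] (t : R) (M : Matrix (Fin a) (Fin a) R) :
    ∃ u, (krylov (t • M)).det = u * (krylov M).det := by
  refine ⟨∏ k : Fin a, t ^ (k : ℕ), ?_⟩
  rw [← Matrix.det_mul_row]
  congr 1
  ext i k
  simp [krylov, _root_.smul_pow, Matrix.smul_mulVec]

/-- The linear form `x ↦ trace (M x)`. -/
def traceDual (M : Matrix (Fin a) (Fin a) K) : Dual K (Matrix (Fin a) (Fin a) K) :=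
  Matrix.traceLinearMap (Fin a) K K ∘ₗ LinearMap.mulLeft K M

theorem traceDual_apply (M x : Matrix (Fin a) (Fin a) K) : traceDual M x = (M * x).trace := rfl

theorem exists_traceDual (f : Dual K (Matrix (Fin a) (Fin a) K)) : ∃ M, f = traceDual M := by
  refine ⟨Matrix.of fun i j => f (Matrix.single j i 1), Matrix.ext_linearMap _ fun i j => ?_⟩
  ext
  simp [traceDual_apply, Matrix.trace_mul_single]

/-- Cyclicity gives `trace (M (xy - yx)) = trace ((Mx - xM) y)`, and the trace form is
nondegenerate: the stabilizer is the centralizer of `M`. -/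
theorem mem_radOn_traceDual {r : Fin a → Fin a → Prop} (hr : ∀ i j, r i j)
    {M x : Matrix (Fin a) (Fin a) K} :
    x ∈ radOn (commForm (traceDual M)) (shape K r) ↔ M * x = x * M := by
  have hs : ∀ y, y ∈ shape K r := fun y i j _ => hr i j
  have h : ∀ y, (M * (x * y - y * x)).trace = ((M * x) * y).trace - ((x * M) * y).trace := by
    intro y
    rw [mul_sub, Matrix.trace_sub, mul_assoc, ← mul_assoc M y x, Matrix.trace_mul_comm (M * y) x,
      mul_assoc]
  simp only [mem_radOn, hs, true_and, commForm_apply, traceDual_apply, true_imp_iff, h, sub_eq_zero]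
  exact Matrix.ext_iff_trace_mul_right.symm

/-- The hypothesis says that the all-ones vector is cyclic for `M`. An element of the centralizer is
determined by its value on a cyclic vector, which bounds the dimension above; the first `a` powers
of `M` are independent and commute with `M`, which bounds it below. -/
theorem stabDim_traceDual {r : Fin a → Fin a → Prop} (hr : ∀ i j, r i j)
    {M : Matrix (Fin a) (Fin a) K} (hM : (krylov M).det ≠ 0) : stabDim r (traceDual M) = a := by
  have hu : IsUnit (krylov M) := (Matrix.isUnit_iff_isUnit_det _).2 hM.isUnit
  apply le_antisymm
  · let φ : radOn (commForm (traceDual M)) (shape K r) →ₗ[K] (Fin a → K) :=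
      { toFun := fun x => x.1.mulVec 1
        map_add' := fun x y => Matrix.add_mulVec _ _ _
        map_smul' := fun c x => Matrix.smul_mulVec _ _ _ }
    have hφ : Function.Injective φ := by
      rw [← LinearMap.ker_eq_bot, LinearMap.ker_eq_bot']
      rintro ⟨x, hx⟩ h0
      have hx' : Commute M x := (mem_radOn_traceDual hr).1 hx
      have h0' : x.mulVec 1 = 0 := h0
      have : x * krylov M = 0 := by
        ext i k
        change x.mulVec ((M ^ (k : ℕ)).mulVec 1) i = 0
        rw [Matrix.mulVec_mulVec, ← (hx'.pow_left k).eq, ← Matrix.mulVec_mulVec, h0']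
        simp
      exact Subtype.ext (hu.mul_left_eq_zero.1 this)
    simpa [stabDim] using LinearMap.finrank_le_finrank_of_injective hφ
  · let ψ : (Fin a → K) →ₗ[K] radOn (commForm (traceDual M)) (shape K r) :=
      Fintype.linearCombination K (fun k : Fin a =>
        (⟨M ^ (k : ℕ), (mem_radOn_traceDual hr).2 (Commute.self_pow M k)⟩ :
          radOn (commForm (traceDual M)) (shape K r)))
    have hψ : Function.Injective ψ := by
      rw [← LinearMap.ker_eq_bot, LinearMap.ker_eq_bot']
      intro c hc
      have h1 : ∑ k : Fin a, c k • M ^ (k : ℕ) = 0 := by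
        simpa [ψ, Fintype.linearCombination_apply] using congrArg Subtype.val hc
      have h2 : (krylov M).mulVec c = 0 := by
        have := congrArg (fun A : Matrix (Fin a) (Fin a) K => A.mulVec 1) h1
        simp only [Matrix.sum_mulVec, Matrix.zero_mulVec] at this
        rw [← this]
        ext i
        simp [krylov, Matrix.mulVec, dotProduct, Finset.sum_apply, Finset.mul_sum, mul_comm]
      exact Matrix.eq_zero_of_mulVec_eq_zero hM h2
    simpa [stabDim] using LinearMap.finrank_le_finrank_of_injective hψ

/-- In the parameter `s = t⁻¹` the determinant for `J + s F` is a polynomial whose value at `0` is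
nonzero by `hJ`, so it has finitely many roots; `t = 0` is set apart. -/
theorem finite_det_krylov_eq_zero (F J : Matrix (Fin a) (Fin a) K) (hJ : (krylov J).det ≠ 0) :
    {t : K | (krylov (F + t • J)).det = 0}.Finite := by
  let H : Matrix (Fin a) (Fin a) K[X] := J.map C + (X : K[X]) • F.map C
  let p : K[X] := (krylov H).det
  have hp : ∀ s, p.eval s = (krylov (J + s • F)).det := by
    intro s
    rw [← Polynomial.coe_evalRingHom, map_det_krylov]
    congr 2
    ext i j
    simp [H, mul_comm s]
  have hp0 : p ≠ 0 := by
    intro h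
    apply hJ
    have := hp 0
    rw [h] at this
    simpa using this.symm
  refine ((p.rootSet_finite K).image (fun s => s⁻¹) |>.insert 0).subset fun t ht => ?_
  by_cases ht0 : t = 0
  · exact Or.inl ht0
  · refine Or.inr ⟨t⁻¹, ?_, inv_inv t⟩
    rw [Polynomial.mem_rootSet]
    refine ⟨hp0, ?_⟩
    rw [Polynomial.coe_aeval_eq_eval, hp]
    have h1 : J + t⁻¹ • F = t⁻¹ • (F + t • J) := by
      rw [smul_add, smul_smul, inv_mul_cancel₀ ht0, one_smul, add_comm]
    obtain ⟨u, hu⟩ := det_krylov_smul t⁻¹ (F + t • J)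
    rw [h1, hu, show (krylov (F + t • J)).det = 0 from ht, mul_zero]

/-- A minimizing form is moved in the direction of a diagonal matrix with distinct entries, for
which the Krylov determinant is a Vandermonde determinant, until its own matrix has a cyclic vector.
-/
theorem relIndex_full [Infinite K] {r : Fin a → Fin a → Prop} (hr : ∀ i j, r i j) :
    relIndex K r = a := by
  obtain ⟨d, hd⟩ : ∃ d : Fin a → K, Function.Injective d :=
    ⟨_, ((Fin.valEmbedding).trans (Infinite.natEmbedding K)).injective⟩
  have hJ : (krylov (Matrix.diagonal d)).det ≠ 0 := by
    rw [krylov_diagonal]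
    exact Matrix.det_vandermonde_ne_zero_iff.2 hd
  obtain ⟨f, t, ht, hft⟩ := exists_stabDim_eq_of_finite r (traceDual (Matrix.diagonal d))
    (fun f => {t : K | (krylov ((exists_traceDual f).choose + t • Matrix.diagonal d)).det = 0})
    (fun f => finite_det_krylov_eq_zero _ _ hJ)
  rw [← hft]
  convert stabDim_traceDual hr ht using 2
  conv_lhs => rw [(exists_traceDual f).choose_spec]
  ext x : 1
  simp [traceDual_apply, add_mul]

end Full

end SeaweedMeander

end

noncomputable section

namespace SeaweedMeander

set_option linter.unusedSectionVars false

open Module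

/-! ### Panyushev's reduction -/

section Reduction

variable {K : Type*} [Field K] {N : Type*} [Fintype N] [DecidableEq N]

theorem mul_mem_shape {r : N → N → Prop} (hr : ∀ i j k, r i j → r j k → r i k)
    {A B : Matrix N N K} (hA : A ∈ shape K r) (hB : B ∈ shape K r) : A * B ∈ shape K r := by
  intro i k h
  rw [Matrix.mul_apply] at h
  obtain ⟨j, -, hj⟩ := Finset.exists_ne_zero_of_sum_ne_zero h
  exact hr i j k (hA i j (left_ne_zero_of_mul hj)) (hB j k (right_ne_zero_of_mul hj))

/-- By transitivity the commutators stay in the algebra, so values of the form outside it are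
irrelevant. -/
theorem stabDim_congr {r : N → N → Prop} (hr : ∀ i j k, r i j → r j k → r i k)
    {f f' : Dual K (Matrix N N K)} (h : ∀ x ∈ shape K r, f x = f' x) :
    stabDim r f = stabDim r f' := by
  refine finrank_radOn_transport LinearMap.id (fun x _ h => h) (Submodule.map_id _) ?_
  intro x hx y hy
  exact (h _ (Submodule.sub_mem _ (mul_mem_shape hr hx hy) (mul_mem_shape hr hy hx))).symm

theorem stabDim_conj {r : N → N → Prop} (hr : ∀ i j k, r i j → r j k → r i k)
    {u u' : Matrix N N K} (hu : u ∈ shape K r) (hu' : u' ∈ shape K r) (h : u * u' = 1)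
    (f : Dual K (Matrix N N K)) :
    stabDim r (f ∘ₗ (LinearMap.mulRight K u' ∘ₗ LinearMap.mulLeft K u)) = stabDim r f := by
  have h' : u' * u = 1 := mul_eq_one_comm.1 h
  refine finrank_radOn_transport (LinearMap.mulRight K u' ∘ₗ LinearMap.mulLeft K u) ?_ ?_ ?_
  · intro x _ hx
    have hx' : u * x * u' = 0 := hx
    calc x = (u' * u) * x * (u' * u) := by rw [h', one_mul, mul_one]
      _ = u' * (u * x * u') * u := by noncomm_ring
      _ = 0 := by rw [hx']; simp
  · ext z
    constructor
    · rintro ⟨x, hx, rfl⟩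
      exact mul_mem_shape hr (mul_mem_shape hr hu hx) hu'
    · intro hz
      refine ⟨u' * z * u, mul_mem_shape hr (mul_mem_shape hr hu' hz) hu, ?_⟩
      change u * (u' * z * u) * u' = z
      calc u * (u' * z * u) * u' = (u * u') * z * (u * u') := by noncomm_ring
        _ = z := by rw [h, one_mul, mul_one]
  · intro x _ y _
    change f ((u * x * u') * (u * y * u') - (u * y * u') * (u * x * u')) =
      f (u * (x * y - y * x) * u')
    congr 1
    calc (u * x * u') * (u * y * u') - (u * y * u') * (u * x * u')
        = u * x * (u' * u) * y * u' - u * y * (u' * u) * x * u' := by noncomm_ring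
      _ = u * (x * y - y * x) * u' := by rw [h']; noncomm_ring

variable {D₁ D₂ Q : Type*}

/-- The relation `r'` on `D₁ ⊕ Q` is obtained from the relation `r` on `(D₁ ⊕ D₂) ⊕ Q` by a
reduction: `D₁ ⊕ D₂` is a full block which receives arrows from `U` and from the image of `w`
only, and `D₂` gets identified with the image of `w`. -/
structure IsReduction (r : (D₁ ⊕ D₂) ⊕ Q → (D₁ ⊕ D₂) ⊕ Q → Prop) (r' : D₁ ⊕ Q → D₁ ⊕ Q → Prop)
    (w : D₂ → Q) (U : Q → Prop) : Prop where
  injective : Function.Injective w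
  trans : ∀ i j k, r i j → r j k → r i k
  trans' : ∀ i j k, r' i j → r' j k → r' i k
  refl : ∀ i, r i i
  not_U : ∀ e, ¬ U (w e)
  isEmpty_or : IsEmpty D₁ ∨ ∀ q, ¬ U q
  inl_inl : ∀ d d', r (.inl d) (.inl d')
  inl_inr : ∀ d q, ¬ r (.inl d) (.inr q)
  inr_inl : ∀ q d, r (.inr q) (.inl d) ↔ U q ∨ q ∈ Set.range w
  w_U : ∀ e q, U q → r (.inr (w e)) (.inr q)
  inl_inl' : ∀ d d', r' (.inl d) (.inl d')
  inl_inr' : ∀ d q, ¬ r' (.inl d) (.inr q)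
  inr_inl' : ∀ q d, r' (.inr q) (.inl d) ↔ q ∈ Set.range w
  inr_inr' : ∀ q q', r' (.inr q) (.inr q') ↔ r (.inr q) (.inr q') ∧ ¬ (q ∈ Set.range w ∧ U q')

/-- The embedding of the reduced algebra. -/
def redEmb (K : Type*) [Field K] (D₁ : Type*) {D₂ Q : Type*} (w : D₂ → Q) :
    Matrix (D₁ ⊕ Q) (D₁ ⊕ Q) K →ₗ[K] Matrix ((D₁ ⊕ D₂) ⊕ Q) ((D₁ ⊕ D₂) ⊕ Q) K where
  toFun x := Matrix.fromBlocks (x.submatrix (Sum.map id w) (Sum.map id w)) 0 0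
    (x.submatrix .inr .inr)
  map_add' x y := by rw [Matrix.fromBlocks_add]; simp [Matrix.submatrix_add]
  map_smul' c x := by rw [Matrix.fromBlocks_smul]; simp [Matrix.submatrix_smul]

theorem redEmb_apply (w : D₂ → Q) (x : Matrix (D₁ ⊕ Q) (D₁ ⊕ Q) K) :
    redEmb K D₁ w x = Matrix.fromBlocks (x.submatrix (Sum.map id w) (Sum.map id w)) 0 0
      (x.submatrix .inr .inr) := rfl

/-- The standard form on the abelian ideal. -/
def redForm (K : Type*) [Field K] (D₁ : Type*) {D₂ Q : Type*} [Fintype D₂] (w : D₂ → Q) :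
    Dual K (Matrix ((D₁ ⊕ D₂) ⊕ Q) ((D₁ ⊕ D₂) ⊕ Q) K) where
  toFun x := ∑ e, x (.inr (w e)) (.inl (.inr e))
  map_add' x y := by simp [Finset.sum_add_distrib]
  map_smul' c x := by simp [Finset.mul_sum]

theorem redForm_apply [Fintype D₂] (w : D₂ → Q) (x : Matrix ((D₁ ⊕ D₂) ⊕ Q) ((D₁ ⊕ D₂) ⊕ Q) K) :
    redForm K D₁ w x = ∑ e, x (.inr (w e)) (.inl (.inr e)) := rfl

namespace IsReduction

variable {r : (D₁ ⊕ D₂) ⊕ Q → (D₁ ⊕ D₂) ⊕ Q → Prop} {r' : D₁ ⊕ Q → D₁ ⊕ Q → Prop}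
    {w : D₂ → Q} {U : Q → Prop}

/-- The set of rows of the ideal is closed under predecessors, by transitivity through a point of
`D₂`. This is what makes the lower left block an ideal. -/
theorem closed [Nonempty D₂] (h : IsReduction r r' w U) {q t : Q} (hqt : r (.inr q) (.inr t))
    (ht : U t ∨ t ∈ Set.range w) : U q ∨ q ∈ Set.range w := by
  obtain ⟨e⟩ := ‹Nonempty D₂›
  rw [← h.inr_inl q (.inr e)]
  exact h.trans _ _ _ hqt ((h.inr_inl t (.inr e)).2 ht)

/-- Only intermediate indices outside `D₁` and the image of `w` could spoil multiplicativity. From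
`D₁` nothing leads into `Q`; between two points of the image such an index would lie in `U` by
`closed`, and `r'` has no arrows from the image of `w` to `U`. -/
theorem redEmb_mul [Fintype D₁] [Fintype D₂] [Fintype Q] [Nonempty D₂]
    (h : IsReduction r r' w U)
    {x y : Matrix (D₁ ⊕ Q) (D₁ ⊕ Q) K} (hx : x ∈ shape K r') (hy : y ∈ shape K r') :
    redEmb K D₁ w (x * y) = redEmb K D₁ w x * redEmb K D₁ w y := by
  rw [redEmb_apply, redEmb_apply, redEmb_apply, Matrix.fromBlocks_multiply]
  simp only [Matrix.mul_zero, Matrix.zero_mul, add_zero, zero_add]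
  congr 1
  · ext i j
    rw [Matrix.submatrix_apply, Matrix.mul_apply, Matrix.mul_apply]
    symm
    refine Fintype.sum_of_injective (Sum.map id w) (Function.injective_id.sumMap h.injective) _ _
      ?_ (fun k => rfl)
    rintro (d | q) hk
    · exact absurd ⟨.inl d, rfl⟩ hk
    · have hq : q ∉ Set.range w := by
        rintro ⟨e, rfl⟩
        exact hk ⟨.inr e, rfl⟩
      by_contra hne
      have h1 := hx _ _ (left_ne_zero_of_mul hne)
      have h2 := hy _ _ (right_ne_zero_of_mul hne)
      rcases i with d | e
      · exact h.inl_inr' _ _ h1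
      · rcases j with d' | e'
        · exact hq ((h.inr_inl' _ _).1 h2)
        · have h3 := (h.inr_inr' _ _).1 h2
          have h4 := (h.inr_inr' _ _).1 h1
          rcases h.closed h3.1 (Or.inr ⟨e', rfl⟩) with h5 | h5
          · exact h4.2 ⟨⟨e, rfl⟩, h5⟩
          · exact hq h5
  · ext q q'
    rw [Matrix.submatrix_apply, Matrix.mul_apply, Matrix.mul_apply, Fintype.sum_sum_type,
      Finset.sum_eq_zero, zero_add]
    · rfl
    · intro d _
      rw [eq_zero_of_mem_shape hy (h.inl_inr' d q'), mul_zero]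

/-- The complement of the abelian ideal. -/
def compl (K : Type*) [Field K] (r : (D₁ ⊕ D₂) ⊕ Q → (D₁ ⊕ D₂) ⊕ Q → Prop) :
    Submodule K (Matrix ((D₁ ⊕ D₂) ⊕ Q) ((D₁ ⊕ D₂) ⊕ Q) K) :=
  shape K fun i j => r i j ∧ (i.isLeft ↔ j.isLeft)

/-- The abelian ideal. -/
def ideal (K : Type*) [Field K] (r : (D₁ ⊕ D₂) ⊕ Q → (D₁ ⊕ D₂) ⊕ Q → Prop) :
    Submodule K (Matrix ((D₁ ⊕ D₂) ⊕ Q) ((D₁ ⊕ D₂) ⊕ Q) K) :=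
  shape K fun i j => r i j ∧ i.isRight ∧ j.isLeft

theorem mem_compl (h : IsReduction r r' w U)
    {x : Matrix ((D₁ ⊕ D₂) ⊕ Q) ((D₁ ⊕ D₂) ⊕ Q) K} :
    x ∈ compl K r ↔ ∃ g p, x = Matrix.fromBlocks g 0 0 p ∧
      ∀ q q', p q q' ≠ 0 → r (.inr q) (.inr q') := by
  constructor
  · intro hx
    refine ⟨x.toBlocks₁₁, x.toBlocks₂₂, ?_, fun q q' hq => (hx _ _ hq).1⟩
    ext (i | i) (j | j)
    · rfl
    · exact eq_zero_of_mem_shape hx (by simp)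
    · exact eq_zero_of_mem_shape hx (by simp)
    · rfl
  · rintro ⟨g, p, rfl, hp⟩ (i | i) (j | j) hij
    · simpa using h.inl_inl i j
    · simp at hij
    · simp at hij
    · simpa using hp i j hij

theorem mem_ideal (h : IsReduction r r' w U)
    {x : Matrix ((D₁ ⊕ D₂) ⊕ Q) ((D₁ ⊕ D₂) ⊕ Q) K} :
    x ∈ ideal K r ↔ ∃ v, x = Matrix.fromBlocks 0 0 v 0 ∧
      ∀ q d, v q d ≠ 0 → U q ∨ q ∈ Set.range w := by
  constructor
  · intro hx
    refine ⟨x.toBlocks₂₁, ?_, fun q d hq => (h.inr_inl q d).1 (hx _ _ hq).1⟩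
    ext (i | i) (j | j)
    · exact eq_zero_of_mem_shape hx (by simp)
    · exact eq_zero_of_mem_shape hx (by simp)
    · rfl
    · exact eq_zero_of_mem_shape hx (by simp)
  · rintro ⟨v, rfl, hv⟩ (i | i) (j | j) hij
    · simp at hij
    · simp at hij
    · simpa using (h.inr_inl i j).2 (hv i j hij)
    · simp at hij

theorem shape_eq_sup (h : IsReduction r r' w U) : shape K r = compl K r ⊔ ideal K r := by
  apply le_antisymm
  · intro x hx
    refine Submodule.mem_sup.2 ⟨Matrix.fromBlocks x.toBlocks₁₁ 0 0 x.toBlocks₂₂,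
      h.mem_compl.2 ⟨_, _, rfl, fun q q' hq => hx _ _ hq⟩,
      Matrix.fromBlocks 0 0 x.toBlocks₂₁ 0,
      h.mem_ideal.2 ⟨_, rfl, fun q d hq => (h.inr_inl q d).1 (hx _ _ hq)⟩, ?_⟩
    ext (i | i) (j | j)
    · simp [Matrix.toBlocks₁₁]
    · simp [eq_zero_of_mem_shape hx (h.inl_inr i j)]
    · simp [Matrix.toBlocks₂₁]
    · simp [Matrix.toBlocks₂₂]
  · exact sup_le (fun x hx i j hij => (hx i j hij).1) (fun x hx i j hij => (hx i j hij).1)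

variable [Fintype D₁] [DecidableEq D₁] [Fintype D₂] [DecidableEq D₂] [Fintype Q] [DecidableEq Q]

theorem commForm_compl_ideal {f : Dual K (Matrix ((D₁ ⊕ D₂) ⊕ Q) ((D₁ ⊕ D₂) ⊕ Q) K)}
    (g : Matrix (D₁ ⊕ D₂) (D₁ ⊕ D₂) K) (p : Matrix Q Q K) (v : Matrix Q (D₁ ⊕ D₂) K) :
    commForm f (Matrix.fromBlocks g 0 0 p) (Matrix.fromBlocks 0 0 v 0) =
      f (Matrix.fromBlocks 0 0 (p * v - v * g) 0) := by
  rw [commForm_apply]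
  congr 1
  simp [Matrix.fromBlocks_multiply, sub_eq_add_neg, Matrix.fromBlocks_neg, Matrix.fromBlocks_add]

theorem mul_sub_mem_ideal [Nonempty D₂] (h : IsReduction r r' w U)
    (g : Matrix (D₁ ⊕ D₂) (D₁ ⊕ D₂) K) {p : Matrix Q Q K}
    (hp : ∀ q q', p q q' ≠ 0 → r (.inr q) (.inr q')) {v : Matrix Q (D₁ ⊕ D₂) K}
    (hv : ∀ q d, v q d ≠ 0 → U q ∨ q ∈ Set.range w) :
    Matrix.fromBlocks 0 0 (p * v - v * g) 0 ∈ ideal K r := by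
  refine h.mem_ideal.2 ⟨_, rfl, fun q d hq => ?_⟩
  by_cases h1 : (p * v) q d = 0
  · rw [Matrix.sub_apply, h1, zero_sub, neg_ne_zero, Matrix.mul_apply] at hq
    obtain ⟨k, -, hk⟩ := Finset.exists_ne_zero_of_sum_ne_zero hq
    exact hv q k (left_ne_zero_of_mul hk)
  · rw [Matrix.mul_apply] at h1
    obtain ⟨k, -, hk⟩ := Finset.exists_ne_zero_of_sum_ne_zero h1
    exact h.closed (hp _ _ (left_ne_zero_of_mul hk)) (hv k d (right_ne_zero_of_mul hk))

/-- The forms which restrict to the standard form on the abelian ideal. -/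
def IsStandard (r : (D₁ ⊕ D₂) ⊕ Q → (D₁ ⊕ D₂) ⊕ Q → Prop) (w : D₂ → Q)
    (f : Dual K (Matrix ((D₁ ⊕ D₂) ⊕ Q) ((D₁ ⊕ D₂) ⊕ Q) K)) : Prop :=
  ∀ x ∈ ideal K r, f x = redForm K D₁ w x

theorem redForm_fromBlocks (g : Matrix (D₁ ⊕ D₂) (D₁ ⊕ D₂) K) (p : Matrix Q Q K)
    (v : Matrix Q (D₁ ⊕ D₂) K) :
    redForm K D₁ w (Matrix.fromBlocks 0 0 (p * v - v * g) 0) =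
      ∑ e, (p * v) (w e) (.inr e) - ∑ e, (v * g) (w e) (.inr e) := by
  simp [redForm_apply]

/-- The abelian ideal is isotropic and, for a standard form, pairs without kernel against its
complement. The part of the complement orthogonal to the ideal is the image of the reduced algebra,
so `finrank_radOn_isotropic` applies. -/
theorem stabDim_eq [Nonempty D₂] (h : IsReduction r r' w U)
    {f : Dual K (Matrix ((D₁ ⊕ D₂) ⊕ Q) ((D₁ ⊕ D₂) ⊕ Q) K)} (hf : IsStandard r w f) :
    stabDim r f = stabDim r' (f ∘ₗ redEmb K D₁ w) := by
  have form : ∀ (g : Matrix (D₁ ⊕ D₂) (D₁ ⊕ D₂) K) (p : Matrix Q Q K) (v : Matrix Q (D₁ ⊕ D₂) K),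
      (∀ q q', p q q' ≠ 0 → r (.inr q) (.inr q')) →
      (∀ q d, v q d ≠ 0 → U q ∨ q ∈ Set.range w) →
      commForm f (Matrix.fromBlocks g 0 0 p) (Matrix.fromBlocks 0 0 v 0) =
        ∑ e, (p * v) (w e) (.inr e) - ∑ e, (v * g) (w e) (.inr e) := by
    intro g p v hp hv
    rw [commForm_compl_ideal, hf _ (h.mul_sub_mem_ideal g hp hv), redForm_fromBlocks]
  let C : Submodule K (Matrix ((D₁ ⊕ D₂) ⊕ Q) ((D₁ ⊕ D₂) ⊕ Q) K) :=
    (shape K r').map (redEmb K D₁ w)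
  have hC : ∀ s, s ∈ C ↔ s ∈ compl K r ∧ ∀ v ∈ ideal K r, commForm f s v = 0 := by
    intro s
    constructor
    · rintro ⟨x, hx, rfl⟩
      have hp : ∀ q q', x.submatrix (Sum.inr : Q → D₁ ⊕ Q) Sum.inr q q' ≠ 0 →
        r (.inr q) (.inr q') := fun q q' hq => ((h.inr_inr' q q').1 (hx _ _ hq)).1
      refine ⟨h.mem_compl.2 ⟨_, _, rfl, hp⟩, fun y hy => ?_⟩
      obtain ⟨v, rfl, hv⟩ := h.mem_ideal.1 hy
      rw [redEmb_apply, form _ _ _ hp hv, sub_eq_zero]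
      have h1 : ∀ e, (x.submatrix (Sum.inr : Q → D₁ ⊕ Q) Sum.inr * v) (w e) (.inr e) =
          ∑ e', x (.inr (w e)) (.inr (w e')) * v (w e') (.inr e) := by
        intro e
        rw [Matrix.mul_apply]
        symm
        refine Fintype.sum_of_injective w h.injective _ _ (fun q hq => ?_) (fun e' => rfl)
        by_contra hne
        rcases hv _ _ (right_ne_zero_of_mul hne) with h2 | h2
        · exact ((h.inr_inr' _ _).1 (hx _ _ (left_ne_zero_of_mul hne))).2 ⟨⟨e, rfl⟩, h2⟩
        · exact hq h2
      have h2 : ∀ e, (v * x.submatrix (Sum.map id w) (Sum.map id w)) (w e) (.inr e) =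
          ∑ e', v (w e) (.inr e') * x (.inr (w e')) (.inr (w e)) := by
        intro e
        rw [Matrix.mul_apply, Fintype.sum_sum_type, Finset.sum_eq_zero, zero_add]
        · rfl
        · intro d _
          rw [Matrix.submatrix_apply]
          exact mul_eq_zero_of_right _ (eq_zero_of_mem_shape hx (h.inl_inr' _ _))
      simp only [h1, h2]
      rw [Finset.sum_comm]
      simp only [mul_comm]
    · rintro ⟨hs, hsV⟩
      obtain ⟨g, p, rfl, hp⟩ := h.mem_compl.1 hs
      -- Orthogonality to the ideal is tested on its elementary matrices. The outcome is that `p` on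
      -- the image of `w` agrees with `g` on `D₂`, `p` has no entries from that image to `U`, and
      -- `g` has none from `D₁` to `D₂`.
      have key : ∀ q d, (U q ∨ q ∈ Set.range w) →
          (∑ e, if d = Sum.inr e then p (w e) q else 0) =
            ∑ e, if w e = q then g d (Sum.inr e) else 0 := by
        intro q d hq
        have hv : ∀ q' d', Matrix.single q d (1 : K) q' d' ≠ 0 → U q' ∨ q' ∈ Set.range w := by
          intro q' d' hne
          rw [Matrix.single_apply] at hne
          split_ifs at hne with hh
          · rwa [← hh.1]
          · exact absurd rfl hne
        have := hsV _ (h.mem_ideal.2 ⟨_, rfl, hv⟩)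
        rw [form _ _ _ hp hv, sub_eq_zero] at this
        convert this using 2 with e _ e _
        · split_ifs with hh
          · subst hh
            rw [Matrix.mul_single_apply_same, mul_one]
          · rw [Matrix.mul_single_apply_of_ne _ _ _ _ _ (Ne.symm hh)]
        · split_ifs with hh
          · subst hh
            rw [Matrix.single_mul_apply_same, one_mul]
          · rw [Matrix.single_mul_apply_of_ne _ _ _ _ _ hh]
      have k1 : ∀ e e', p (w e) (w e') = g (.inr e) (.inr e') := by
        intro e e'
        simpa [h.injective.eq_iff] using key (w e') (.inr e) (Or.inr ⟨e', rfl⟩)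
      have k2 : ∀ e u, U u → p (w e) u = 0 := by
        intro e u hu
        have hne : ∀ e', w e' ≠ u := by
          rintro e' rfl
          exact h.not_U e' hu
        simpa [hne] using key u (.inr e) (Or.inl hu)
      have k3 : ∀ d e, g (.inl d) (.inr e) = 0 := by
        intro d e
        simpa [h.injective.eq_iff] using (key (w e) (.inl d) (Or.inr ⟨e, rfl⟩)).symm
      -- The preimage carries the rows of `g` indexed by `D₂` over to the rows indexed by the image
      -- of `w`.
      refine ⟨Matrix.fromBlocks (g.submatrix Sum.inl Sum.inl) 0
        (Matrix.of fun q d => ∑ e, if w e = q then g (Sum.inr e) (Sum.inl d) else 0) p, ?_, ?_⟩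
      · rintro (d | q) (d' | q') hne
        · exact h.inl_inl' _ _
        · simp at hne
        · rw [Matrix.fromBlocks_apply₂₁, Matrix.of_apply] at hne
          obtain ⟨e, -, he⟩ := Finset.exists_ne_zero_of_sum_ne_zero hne
          rw [h.inr_inl']
          by_contra hq
          exact he (if_neg fun hh => hq ⟨e, hh⟩)
        · rw [h.inr_inr']
          rw [Matrix.fromBlocks_apply₂₂] at hne
          refine ⟨hp _ _ hne, ?_⟩
          rintro ⟨⟨e, rfl⟩, hu⟩
          exact hne (k2 e _ hu)
      · rw [redEmb_apply]
        congr 1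
        ext (d | e) (d' | e')
        · simp
        · simp [k3]
        · simp [h.injective.eq_iff]
        · simp [k1]
  let π : Matrix ((D₁ ⊕ D₂) ⊕ Q) ((D₁ ⊕ D₂) ⊕ Q) K →ₗ[K]
      Matrix ((D₁ ⊕ D₂) ⊕ Q) ((D₁ ⊕ D₂) ⊕ Q) K :=
    { toFun := fun x => Matrix.fromBlocks x.toBlocks₁₁ 0 0 x.toBlocks₂₂
      map_add' := by intro x y; rw [Matrix.fromBlocks_add]; simp; exact ⟨rfl, rfl⟩
      map_smul' := by intro c x; simp [Matrix.fromBlocks_smul]; exact ⟨rfl, rfl⟩ }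
  have h1 : stabDim r f = finrank K (radOn (commForm f) C) := by
    refine finrank_radOn_isotropic (commForm_antisymm f) h.shape_eq_sup π ?_ ?_ ?_ ?_ hC
    · intro s hs
      obtain ⟨g, p, rfl, -⟩ := h.mem_compl.1 hs
      rfl
    · intro s hs
      obtain ⟨v, rfl, -⟩ := h.mem_ideal.1 hs
      exact Matrix.fromBlocks_zero
    · intro x hx y hy
      obtain ⟨v, rfl, -⟩ := h.mem_ideal.1 hx
      obtain ⟨v', rfl, -⟩ := h.mem_ideal.1 hy
      simp [Matrix.fromBlocks_multiply]
    · intro x hx hx'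
      obtain ⟨v, rfl, hv⟩ := h.mem_ideal.1 hx
      have hx'' : ∀ (g : Matrix (D₁ ⊕ D₂) (D₁ ⊕ D₂) K) (p : Matrix Q Q K),
          (∀ q q', p q q' ≠ 0 → r (.inr q) (.inr q')) →
          ∑ e, (p * v) (w e) (.inr e) = ∑ e, (v * g) (w e) (.inr e) := by
        intro g p hp
        have := hx' _ (h.mem_compl.2 ⟨g, p, rfl, hp⟩)
        rw [commForm_antisymm, form g p v hp hv, neg_eq_zero, sub_eq_zero] at this
        exact this
      have k1 : ∀ e d, v (w e) d = 0 := by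
        intro e d
        have h3 : ∀ e', (v * Matrix.single d (Sum.inr e) (1 : K) : Matrix Q (D₁ ⊕ D₂) K) (w e') (.inr e') =
            if e' = e then v (w e) d else 0 := by
          intro e'
          split_ifs with hh
          · rw [hh, Matrix.mul_single_apply_same, mul_one]
          · rw [Matrix.mul_single_apply_of_ne _ _ _ _ _ (by simpa using hh)]
        simpa [h3] using (hx'' (Matrix.single d (.inr e) 1) 0 (by simp)).symm
      have k2 : ∀ e u, U u → v u (.inr e) = 0 := by
        intro e u hu
        have h3 : ∀ e', (Matrix.single (w e) u (1 : K) * v : Matrix Q (D₁ ⊕ D₂) K) (w e') (.inr e') =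
            if e' = e then v u (.inr e) else 0 := by
          intro e'
          split_ifs with hh
          · rw [hh, Matrix.single_mul_apply_same, one_mul]
          · rw [Matrix.single_mul_apply_of_ne _ _ _ _ _ (by simpa [h.injective.eq_iff] using hh)]
        simpa [h3] using hx'' 0 (Matrix.single (w e) u 1) fun q q' hq => by
          rw [Matrix.single_apply] at hq
          split_ifs at hq with hh
          · rw [← hh.1, ← hh.2]
            exact h.w_U e u hu
          · exact absurd rfl hq
      suffices v = 0 by rw [this, Matrix.fromBlocks_zero]
      ext q d
      by_contra hne
      -- Entries with row in `U` and column in `D₁` are not detected by the pairing; `isEmpty_or`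
      -- ensures that there are none.
      rcases hv q d hne with hu | ⟨e, rfl⟩
      · rcases h.isEmpty_or with hD | hU
        · rcases d with d | e
          · exact hD.elim d
          · exact hne (k2 e q hu)
        · exact hU q hu
      · exact hne (k1 e d)
  rw [h1]
  symm
  refine finrank_radOn_transport (redEmb K D₁ w) ?_ rfl ?_
  · intro x hx h0
    have h0' : Matrix.fromBlocks (x.submatrix (Sum.map id w) (Sum.map id w)) 0 0
      (x.submatrix Sum.inr Sum.inr) = Matrix.fromBlocks 0 0 0 0 := by
      rw [← redEmb_apply, h0, Matrix.fromBlocks_zero]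
    rw [Matrix.fromBlocks_inj] at h0'
    ext (d | q) (d' | q')
    · exact congrFun (congrFun h0'.1 (.inl d)) (.inl d')
    · exact eq_zero_of_mem_shape hx (h.inl_inr' d q')
    · by_contra hne
      obtain ⟨e, rfl⟩ := (h.inr_inl' _ _).1 (hx _ _ hne)
      exact hne (congrFun (congrFun h0'.1 (.inr e)) (.inl d'))
    · exact congrFun (congrFun h0'.2.2.2 q) q'
  · intro x hx y hy
    rw [commForm_apply, commForm_apply, ← h.redEmb_mul hx hy, ← h.redEmb_mul hy hx, ← map_sub]
    rfl

/-- A linear left inverse of `redEmb` on the reduced algebra which vanishes on the ideal. -/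
def redProj (K : Type*) [Field K] (D₁ : Type*) {D₂ Q : Type*} [Fintype D₂] [DecidableEq Q]
    (w : D₂ → Q) :
    Matrix ((D₁ ⊕ D₂) ⊕ Q) ((D₁ ⊕ D₂) ⊕ Q) K →ₗ[K] Matrix (D₁ ⊕ Q) (D₁ ⊕ Q) K where
  toFun z := Matrix.fromBlocks (z.submatrix (Sum.inl ∘ Sum.inl) (Sum.inl ∘ Sum.inl)) 0
    (Matrix.of fun q d => ∑ e, if w e = q then z (.inl (.inr e)) (.inl (.inl d)) else 0)
    (z.submatrix Sum.inr Sum.inr)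
  map_add' x y := by
    rw [Matrix.fromBlocks_add]
    congr 1
    · simp
    · ext q d
      simp only [Matrix.of_apply, Matrix.add_apply, ← Finset.sum_add_distrib]
      exact Finset.sum_congr rfl fun e _ => by split_ifs <;> simp
  map_smul' c x := by
    rw [RingHom.id_apply, Matrix.fromBlocks_smul]
    congr 1
    · simp
    · ext q d
      simp [Matrix.of_apply, Matrix.smul_apply, Finset.mul_sum]

theorem redProj_redEmb (h : IsReduction r r' w U) {x : Matrix (D₁ ⊕ Q) (D₁ ⊕ Q) K}
    (hx : x ∈ shape K r') : redProj K D₁ w (redEmb K D₁ w x) = x := by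
  ext (d | q) (d' | q')
  · rfl
  · exact (eq_zero_of_mem_shape hx (h.inl_inr' d q')).symm
  · change (∑ e, if w e = q then x (.inr (w e)) (.inl d') else 0) = x (.inr q) (.inl d')
    by_cases hq : q ∈ Set.range w
    · obtain ⟨e, rfl⟩ := hq
      simp [h.injective.eq_iff]
    · rw [eq_zero_of_mem_shape hx (mt (h.inr_inl' q d').1 hq)]
      exact Finset.sum_eq_zero fun e _ => if_neg fun hh => hq ⟨e, hh⟩
  · rfl

/-- Every form on the reduced algebra comes from a standard form on the large one: pull it back
along `redProj` and add `redForm`. -/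
theorem relIndex_le_reduced [Nonempty D₂] (h : IsReduction r r' w U) :
    relIndex K r ≤ relIndex K r' := by
  refine le_relIndex fun f => (relIndex_le r (f ∘ₗ redProj K D₁ w + redForm K D₁ w)).trans_eq ?_
  rw [h.stabDim_eq]
  · refine stabDim_congr h.trans' fun x hx => ?_
    rw [LinearMap.comp_apply, LinearMap.add_apply, LinearMap.comp_apply, h.redProj_redEmb hx,
      redForm_apply, Finset.sum_eq_zero, add_zero]
    intro e _
    rfl
  · intro x hx
    obtain ⟨v, rfl, -⟩ := h.mem_ideal.1 hx
    rw [LinearMap.add_apply, LinearMap.comp_apply, add_eq_right]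
    convert map_zero f
    ext (d | q) (d' | q')
    · rfl
    · rfl
    · change (∑ e, if w e = q then (0 : K) else 0) = 0
      simp
    · rfl

/-- The matrix of a linear form on the lower left block. -/
def lowerMatrix (f : Dual K (Matrix ((D₁ ⊕ D₂) ⊕ Q) ((D₁ ⊕ D₂) ⊕ Q) K)) :
    Matrix (D₁ ⊕ D₂) Q K :=
  Matrix.of fun d q => f (Matrix.single (.inr q) (.inl d) 1)

theorem apply_lower (f : Dual K (Matrix ((D₁ ⊕ D₂) ⊕ Q) ((D₁ ⊕ D₂) ⊕ Q) K))
    (v : Matrix Q (D₁ ⊕ D₂) K) :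
    f (Matrix.fromBlocks 0 0 v 0) = (lowerMatrix f * v).trace := by
  let φ : Matrix Q (D₁ ⊕ D₂) K →ₗ[K] Matrix ((D₁ ⊕ D₂) ⊕ Q) ((D₁ ⊕ D₂) ⊕ Q) K :=
    { toFun := fun v => Matrix.fromBlocks 0 0 v 0
      map_add' := by intros; simp [Matrix.fromBlocks_add]
      map_smul' := by intros; simp [Matrix.fromBlocks_smul] }
  have : f ∘ₗ φ = Matrix.traceLinearMap (D₁ ⊕ D₂) K K ∘ₗ
      mulLeftLinearMap (D₁ ⊕ D₂) K (lowerMatrix f) := by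
    refine Matrix.ext_linearMap _ fun q d => ?_
    ext
    have h1 : φ (Matrix.single q d 1) = Matrix.single (.inr q) (.inl d) 1 := by
      ext (i | i) (j | j) <;> simp [φ, Matrix.single_apply]
    simp [h1, Matrix.trace_mul_single, lowerMatrix]
  exact LinearMap.congr_fun this v

/-- Genericity condition on a linear form: the part of its lower left block which is an identity
matrix for the standard form is invertible. -/
def genericBlock (w : D₂ → Q) (f : Dual K (Matrix ((D₁ ⊕ D₂) ⊕ Q) ((D₁ ⊕ D₂) ⊕ Q) K)) :
    Matrix D₂ D₂ K :=
  (lowerMatrix f).submatrix Sum.inr w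

/-- On the ideal `f` is `v ↦ trace (ξ v)`, and conjugation by `diag(g, 1 - E L)` turns `ξ` into `g⁻¹
ξ (1 - E L)`. Row operations on `D₁ ⊕ D₂` bring the columns in the image of `w` to `0` over `1`;
column operations along arrows from that image to `U` then clear the columns in `U`. -/
theorem exists_conj_isStandard (h : IsReduction r r' w U)
    (f : Dual K (Matrix ((D₁ ⊕ D₂) ⊕ Q) ((D₁ ⊕ D₂) ⊕ Q) K)) (hf : IsUnit (genericBlock w f)) :
    ∃ u ∈ shape K r, ∃ u' ∈ shape K r, u * u' = 1 ∧
      IsStandard r w (f ∘ₗ (LinearMap.mulRight K u' ∘ₗ LinearMap.mulLeft K u)) := by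
  classical
  let ξ₁ : Matrix D₁ Q K := (lowerMatrix f).submatrix Sum.inl id
  let ξ₂ : Matrix D₂ Q K := (lowerMatrix f).submatrix Sum.inr id
  have hξ : lowerMatrix f = Matrix.fromRows ξ₁ ξ₂ := by
    ext (i | i) j <;> rfl
  let E : Matrix Q D₂ K := Matrix.of fun q e => if q = w e then 1 else 0
  let P : Matrix Q Q K := Matrix.diagonal fun q => if U q then 1 else 0
  let Y : Matrix D₂ D₂ K := genericBlock w f
  have hYu : IsUnit Y.det := (Matrix.isUnit_iff_isUnit_det _).1 hf
  have hY : ξ₂ * E = Y := by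
    ext i j
    simp [ξ₂, E, Y, genericBlock, Matrix.mul_apply]
  let X : Matrix D₁ D₂ K := ξ₁ * E
  -- `L` is the part of the normalized rows that lies over `U`. As `U` misses the image of `w`, `L *
  -- E = 0`, so `E * L` squares to zero and `1 - E * L` has inverse `1 + E * L`.
  let L : Matrix D₂ Q K := Y⁻¹ * ξ₂ * P
  have hLE : L * E = 0 := by
    have : P * E = 0 := by
      ext q e
      rw [Matrix.diagonal_mul]
      by_cases hq : q = w e
      · simp [hq, h.not_U e]
      · simp [E, hq]
    rw [show L = Y⁻¹ * ξ₂ * P from rfl, Matrix.mul_assoc, this, Matrix.mul_zero]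
  have hEL : E * L * (E * L) = 0 := by
    rw [Matrix.mul_assoc, ← Matrix.mul_assoc L, hLE, Matrix.zero_mul, Matrix.mul_zero]
  have hELr : ∀ q q', (E * L) q q' ≠ 0 → r (.inr q) (.inr q') := by
    intro q q' hne
    rw [Matrix.mul_apply] at hne
    obtain ⟨e, -, he⟩ := Finset.exists_ne_zero_of_sum_ne_zero hne
    have h1 : q = w e := by
      by_contra hq
      exact left_ne_zero_of_mul he (if_neg hq)
    have h2 : U q' := by
      by_contra hq
      apply right_ne_zero_of_mul he
      simp [L, P, Matrix.mul_diagonal, hq]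
    rw [h1]
    exact h.w_U e q' h2
  have hone : ∀ q q', (1 : Matrix Q Q K) q q' ≠ 0 → r (.inr q) (.inr q') := by
    intro q q' hne
    rw [Matrix.one_apply] at hne
    split_ifs at hne with hh
    · rw [hh]
      exact h.refl _
    · exact absurd rfl hne
  have hsh : ∀ g p, (∀ q q', p q q' ≠ 0 → r (.inr q) (.inr q')) →
      Matrix.fromBlocks g 0 0 p ∈ shape K r := fun g p hp => by
    rw [h.shape_eq_sup]
    exact Submodule.mem_sup_left (h.mem_compl.2 ⟨g, p, rfl, hp⟩)
  let g : Matrix (D₁ ⊕ D₂) (D₁ ⊕ D₂) K := Matrix.fromBlocks 1 X 0 Y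
  let g' : Matrix (D₁ ⊕ D₂) (D₁ ⊕ D₂) K := Matrix.fromBlocks 1 (-(X * Y⁻¹)) 0 Y⁻¹
  have hgg : g * g' = 1 := by
    simp only [g, g', Matrix.fromBlocks_multiply]
    rw [Matrix.mul_nonsing_inv _ hYu]
    simp
  refine ⟨Matrix.fromBlocks g 0 0 (1 - E * L), hsh _ _ fun q q' hne => ?_,
    Matrix.fromBlocks g' 0 0 (1 + E * L), hsh _ _ fun q q' hne => ?_, ?_, ?_⟩
  · by_cases h1 : (1 : Matrix Q Q K) q q' = 0
    · rw [Matrix.sub_apply, h1, zero_sub, neg_ne_zero] at hne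
      exact hELr _ _ hne
    · exact hone _ _ h1
  · by_cases h1 : (1 : Matrix Q Q K) q q' = 0
    · rw [Matrix.add_apply, h1, zero_add] at hne
      exact hELr _ _ hne
    · exact hone _ _ h1
  · rw [Matrix.fromBlocks_multiply, hgg]
    have : (1 - E * L) * (1 + E * L) = 1 := by
      rw [sub_mul, mul_add, mul_add, hEL]
      simp
    simp [this]
  · intro x hx
    obtain ⟨v, rfl, hv⟩ := h.mem_ideal.1 hx
    have h1 : Matrix.fromBlocks g 0 0 (1 - E * L) * Matrix.fromBlocks 0 0 v 0 *
        Matrix.fromBlocks g' 0 0 (1 + E * L) =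
        Matrix.fromBlocks 0 0 ((1 - E * L) * v * g') 0 := by
      simp [Matrix.fromBlocks_multiply]
    change f (Matrix.fromBlocks g 0 0 (1 - E * L) * Matrix.fromBlocks 0 0 v 0 *
        Matrix.fromBlocks g' 0 0 (1 + E * L)) = _
    rw [h1, apply_lower, ← Matrix.mul_assoc, Matrix.trace_mul_comm, ← Matrix.mul_assoc,
      ← Matrix.mul_assoc]
    have h2 : g' * lowerMatrix f * (1 - E * L) =
        Matrix.fromRows ((ξ₁ - X * Y⁻¹ * ξ₂)) (Y⁻¹ * ξ₂ - L) := by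
      have e1 : (ξ₁ - X * Y⁻¹ * ξ₂) * E = 0 := by
        rw [Matrix.sub_mul, Matrix.mul_assoc, hY, Matrix.mul_assoc, Matrix.nonsing_inv_mul _ hYu,
          Matrix.mul_one, sub_self]
      have e2 : Y⁻¹ * ξ₂ * E = 1 := by
        rw [Matrix.mul_assoc, hY, Matrix.nonsing_inv_mul _ hYu]
      rw [hξ, Matrix.fromBlocks_mul_fromRows, Matrix.fromRows_mul]
      congr 1
      · rw [Matrix.one_mul, Matrix.neg_mul, ← sub_eq_add_neg, Matrix.mul_sub, ← Matrix.mul_assoc,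
          e1, Matrix.zero_mul, Matrix.mul_one, sub_zero]
      · rw [Matrix.zero_mul, zero_add, Matrix.mul_sub, ← Matrix.mul_assoc, e2, Matrix.one_mul,
          Matrix.mul_one]
    have h3 : ∀ d q, (U q ∨ q ∈ Set.range w) → (ξ₁ - X * Y⁻¹ * ξ₂) d q = 0 := by
      intro d q hq
      rcases hq with hq | ⟨e, rfl⟩
      · rcases h.isEmpty_or with hD | hU
        · exact hD.elim d
        · exact absurd hq (hU q)
      · have e1 : (ξ₁ - X * Y⁻¹ * ξ₂) * E = 0 := by
          rw [Matrix.sub_mul, Matrix.mul_assoc, hY, Matrix.mul_assoc, Matrix.nonsing_inv_mul _ hYu,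
            Matrix.mul_one, sub_self]
        simpa [Matrix.mul_apply, E] using congrFun (congrFun e1 d) e
    have h4 : ∀ e q, (U q ∨ q ∈ Set.range w) →
        (Y⁻¹ * ξ₂ - L) e q = if q = w e then 1 else 0 := by
      intro e q hq
      rcases hq with hq | ⟨e', rfl⟩
      · have : q ≠ w e := by
          rintro rfl
          exact h.not_U e hq
        simp [L, P, Matrix.mul_diagonal, hq, this]
      · have e2 : Y⁻¹ * ξ₂ * E = 1 := by
          rw [Matrix.mul_assoc, hY, Matrix.nonsing_inv_mul _ hYu]
        have e3 : (Y⁻¹ * ξ₂) e (w e') = (1 : Matrix D₂ D₂ K) e e' := by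
          rw [← e2]
          simp [Matrix.mul_apply, E]
        rw [Matrix.sub_apply, e3]
        simp [L, P, Matrix.mul_diagonal, h.not_U, Matrix.one_apply, h.injective.eq_iff, eq_comm]
    rw [h2, redForm_apply, Matrix.trace]
    simp only [Matrix.diag_apply, Fintype.sum_sum_type]
    rw [Finset.sum_eq_zero, zero_add]
    · refine Finset.sum_congr rfl fun e _ => ?_
      rw [Matrix.mul_apply, Finset.sum_eq_single (w e), Matrix.fromRows_apply_inr,
        h4 _ _ (Or.inr ⟨e, rfl⟩), if_pos rfl, one_mul, Matrix.fromBlocks_apply₂₁]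
      · intro q _ hq
        by_cases hv' : v q (.inr e) = 0
        · rw [hv', mul_zero]
        · rw [Matrix.fromRows_apply_inr, h4 _ _ (hv _ _ hv'), if_neg hq, zero_mul]
      · simp
    · intro d _
      rw [Matrix.mul_apply]
      refine Finset.sum_eq_zero fun q _ => ?_
      by_cases hv' : v q (.inl d) = 0
      · rw [hv', mul_zero]
      · rw [Matrix.fromRows_apply_inl, h3 _ _ (hv _ _ hv'), zero_mul]

/-- For the remaining inequality a minimizing form is moved along `redForm` until its generic block
is invertible, and is then conjugated to a standard form. -/
theorem relIndex_eq [Infinite K] [Nonempty D₂] (h : IsReduction r r' w U) :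
    relIndex K r = relIndex K r' := by
  refine le_antisymm h.relIndex_le_reduced ?_
  obtain ⟨f, t, ht, hft⟩ := exists_stabDim_eq_of_finite r (redForm K D₁ w)
    (fun f => {t : K | ¬ IsUnit (genericBlock w (f + t • redForm K D₁ w))}) (fun f => by
      refine ((Matrix.finite_spectrum (genericBlock w f)).image fun t => -t).subset fun t ht => ?_
      -- Adding `t • redForm` adds `t` times the identity to the generic block, so the bad
      -- parameters are the negatives of its spectrum.
      refine ⟨-t, fun hu => ht ?_, neg_neg t⟩
      convert hu.neg using 1
      ext i j
      have hs : redForm K D₁ w (Matrix.single (.inr (w j)) (.inl (.inr i)) 1) =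
          if i = j then 1 else 0 := by
        rw [redForm_apply]
        split_ifs with hij
        · subst hij
          rw [Finset.sum_eq_single i] <;> simp +contextual [eq_comm]
        · refine Finset.sum_eq_zero fun e _ => ?_
          rw [Matrix.single_apply, if_neg]
          rintro ⟨h1, h2⟩
          simp only [Sum.inr.injEq, Sum.inl.injEq, h.injective.eq_iff] at h1 h2
          exact hij (h2.trans h1.symm)
      simp [genericBlock, lowerMatrix, hs, Matrix.algebraMap_matrix_apply])
  obtain ⟨u, hu, u', hu', huu, hst⟩ := h.exists_conj_isStandard _ (not_not.1 ht)
  rw [← hft, ← stabDim_conj h.trans hu hu' huu, h.stabDim_eq hst]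
  exact relIndex_le _ _

end IsReduction
end Reduction
end SeaweedMeander
end

noncomputable section

namespace SeaweedMeander

open Module

/-! ### Seaweeds of pairs of lists -/

section Lists

/-- Two positions lie in the same block of a list of block sizes. -/
def sameBlock : List ℕ → ℕ → ℕ → Prop
  | [], _, _ => False
  | a :: l, i, j => (i < a ∧ j < a) ∨ (a ≤ i ∧ a ≤ j ∧ sameBlock l (i - a) (j - a))

theorem sameBlock_cons {a : ℕ} {l : List ℕ} {i j : ℕ} : sameBlock (a :: l) i j ↔
    (i < a ∧ j < a) ∨ (a ≤ i ∧ a ≤ j ∧ sameBlock l (i - a) (j - a)) := Iff.rfl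

theorem sameBlock_symm {l : List ℕ} {i j : ℕ} (h : sameBlock l i j) : sameBlock l j i := by
  induction l generalizing i j with
  | nil => exact h
  | cons a l ih =>
    rcases h with h | h
    · exact Or.inl h.symm
    · exact Or.inr ⟨h.2.1, h.1, ih h.2.2⟩

theorem sameBlock_trans {l : List ℕ} {i j k : ℕ} (h : sameBlock l i j) (h' : sameBlock l j k) :
    sameBlock l i k := by
  induction l generalizing i j k with
  | nil => exact h
  | cons a l ih =>
    rcases h with h | h <;> rcases h' with h' | h'
    · exact Or.inl ⟨h.1, h'.2⟩
    · omega
    · omega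
    · exact Or.inr ⟨h.1, h'.2.1, ih h.2.2 h'.2.2⟩

theorem sameBlock_refl {l : List ℕ} {i : ℕ} (h : i < l.sum) : sameBlock l i i := by
  induction l generalizing i with
  | nil => simp at h
  | cons a l ih =>
    rw [List.sum_cons] at h
    rcases lt_or_ge i a with h' | h'
    · exact Or.inl ⟨h', h'⟩
    · exact Or.inr ⟨h', h', ih (by omega)⟩

theorem lt_sum_of_sameBlock {l : List ℕ} {i j : ℕ} (h : sameBlock l i j) : i < l.sum := by
  induction l generalizing i j with
  | nil => exact h.elim
  | cons a l ih =>
    rw [List.sum_cons]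
    rcases h with h | h
    · omega
    · have := ih h.2.2
      omega

theorem sameBlock_left_of_between {l : List ℕ} {i k j : ℕ} (hik : i ≤ k) (hkj : k ≤ j)
    (h : sameBlock l i j) : sameBlock l i k := by
  induction l generalizing i j k with
  | nil => exact h
  | cons a l ih =>
    rcases h with h | h
    · exact Or.inl (by omega)
    · exact Or.inr ⟨h.1, by omega, ih (by omega) (by omega) h.2.2⟩

theorem sameBlock_append {l m : List ℕ} {i j : ℕ} : sameBlock (l ++ m) i j ↔
    sameBlock l i j ∨ (l.sum ≤ i ∧ l.sum ≤ j ∧ sameBlock m (i - l.sum) (j - l.sum)) := by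
  induction l generalizing i j with
  | nil => simp [sameBlock]
  | cons a l ih =>
    simp only [List.cons_append, sameBlock_cons, ih, List.sum_cons, Nat.sub_sub]
    grind

/-- The form with partial sums is the one that matches `Composition.sizeUpTo`. -/
theorem sameBlock_iff_take {l : List ℕ} {i j : ℕ} : sameBlock l i j ↔
    ∃ k, ((l.take k).sum ≤ i ∧ i < (l.take (k + 1)).sum) ∧
      ((l.take k).sum ≤ j ∧ j < (l.take (k + 1)).sum) := by
  induction l generalizing i j with
  | nil => simp [sameBlock]
  | cons a l ih =>
    rw [sameBlock_cons, ih]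
    constructor
    · rintro (h | ⟨h1, h2, k, hk⟩)
      · exact ⟨0, by simpa using h⟩
      · refine ⟨k + 1, ?_⟩
        simp only [List.take_succ_cons, List.sum_cons]
        omega
    · rintro ⟨k, hk⟩
      rcases k with _ | k
      · exact Or.inl (by simpa using hk)
      · simp only [List.take_succ_cons, List.sum_cons] at hk
        exact Or.inr ⟨by omega, by omega, k, by omega⟩

/-- The relation supporting the seaweed algebra of a pair of lists of block sizes. -/
def seaRel (l m : List ℕ) (i j : ℕ) : Prop :=
  (i ≤ j → sameBlock l i j) ∧ (j ≤ i → sameBlock m i j)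

theorem seaRel_trans {l m : List ℕ} {i j k : ℕ} (h : seaRel l m i j) (h' : seaRel l m j k) :
    seaRel l m i k := by
  constructor
  · intro hik
    rcases le_total i j with hij | hij
    · rcases le_total j k with hjk | hjk
      · exact sameBlock_trans (h.1 hij) (h'.1 hjk)
      · exact sameBlock_left_of_between hik hjk (h.1 hij)
    · have := h'.1 (hij.trans hik)
      exact sameBlock_trans (sameBlock_symm (sameBlock_left_of_between hij hik this)) this
  · intro hki
    rcases le_total j i with hij | hij
    · rcases le_total k j with hjk | hjk
      · exact sameBlock_trans (h.2 hij) (h'.2 hjk)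
      · have := sameBlock_symm (h.2 hij)
        exact sameBlock_trans (sameBlock_symm this) (sameBlock_left_of_between hjk hki this)
    · have := sameBlock_symm (h'.2 (hki.trans hij))
      exact sameBlock_symm (sameBlock_left_of_between hki hij this)

theorem seaRel_flip {l m : List ℕ} {i j : ℕ} : seaRel l m i j ↔ seaRel m l j i :=
  ⟨fun h => ⟨fun hij => sameBlock_symm (h.2 hij), fun hij => sameBlock_symm (h.1 hij)⟩,
    fun h => ⟨fun hij => sameBlock_symm (h.2 hij), fun hij => sameBlock_symm (h.1 hij)⟩⟩

variable {K : Type*} [Field K]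

/-- The index of the seaweed algebra of a pair of lists of block sizes with the same sum. -/
def listIndex (K : Type*) [Field K] (l m : List ℕ) : ℕ :=
  relIndex K fun i j : Fin l.sum => seaRel l m i j

theorem relIndex_eq_of_injective {N : Type*} [Fintype N] [DecidableEq N] {n : ℕ} (φ : N → ℕ)
    (hφ : Function.Injective φ) (hlt : ∀ i, φ i < n) (hcard : Fintype.card N = n)
    (R : ℕ → ℕ → Prop) :
    relIndex K (fun i j : Fin n => R i j) = relIndex K (fun i j : N => R (φ i) (φ j)) := by
  have hinj : Function.Injective fun i => (⟨φ i, hlt i⟩ : Fin n) := fun i j hij =>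
    hφ (congrArg Fin.val hij)
  have hbij := (Fintype.bijective_iff_injective_and_card _).2 ⟨hinj, by simpa using hcard⟩
  exact (relIndex_equiv (Equiv.ofBijective _ hbij) fun i j => Iff.rfl).symm

theorem listIndex_comm {l m : List ℕ} (h : l.sum = m.sum) : listIndex K l m = listIndex K m l := by
  rw [listIndex, listIndex, ← relIndex_flip]
  exact relIndex_equiv (finCongr h) fun i j => seaRel_flip

theorem listIndex_nil : listIndex K [] [] = 0 :=
  have : IsEmpty (Fin ([] : List ℕ).sum) := by simp; infer_instance
  relIndex_of_isEmpty _

theorem listIndex_append {l l' m m' : List ℕ} (h : l.sum = m.sum) (h' : l'.sum = m'.sum) :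
    listIndex K (l ++ l') (m ++ m') = listIndex K l m + listIndex K l' m' := by
  rw [listIndex, relIndex_eq_of_injective (N := Fin l.sum ⊕ Fin l'.sum)
    (Sum.elim (fun i => i) fun i => l.sum + i)]
  · have hnot : ∀ (l m : List ℕ) (i j : ℕ), i < l.sum → l.sum ≤ j → ¬ sameBlock (l ++ m) i j := by
      intro l m i j hi hj hij
      rw [sameBlock_append] at hij
      rcases hij with hij | hij
      · have := lt_sum_of_sameBlock (sameBlock_symm hij)
        omega
      · omega
    have hl : ∀ (l m : List ℕ) (i j : ℕ), i < l.sum →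
        (sameBlock (l ++ m) i j ↔ sameBlock l i j) := by
      intro l m i j hi
      rw [sameBlock_append, or_iff_left]
      omega
    have hr : ∀ (l m : List ℕ) (i j : ℕ),
        (sameBlock (l ++ m) (l.sum + i) (l.sum + j) ↔ sameBlock m i j) := by
      intro l m i j
      rw [sameBlock_append, or_iff_right]
      · simp
      · intro hij
        have := lt_sum_of_sameBlock hij
        omega
    refine relIndex_sum (fun i j => ?_) (fun i j => ?_) (fun i j => ?_) fun i j => ?_
    · simp only [Sum.elim_inl, seaRel]
      rw [hl _ _ _ _ i.2, hl _ _ _ _ (h ▸ i.2)]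
    · simp only [Sum.elim_inr, seaRel]
      rw [hr, h, hr]
      simp
    · rintro ⟨h1, -⟩
      exact hnot l l' i (l.sum + j) i.2 (by omega) (h1 (by simp; omega))
    · rintro ⟨-, h1⟩
      exact hnot m m' j (l.sum + i) (h ▸ j.2) (by omega) (sameBlock_symm (h1 (by simp; omega)))
  · rintro (i | i) (j | j) hij
    · simpa [Fin.ext_iff] using hij
    · simp at hij
      omega
    · simp at hij
      omega
    · simpa [Fin.ext_iff] using hij
  · rintro (i | i) <;> simp <;> omega
  · simp

theorem listIndex_singleton [Infinite K] (a : ℕ) : listIndex K [a] [a] = a := by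
  have h := relIndex_full (K := K) (r := fun i j : Fin ([a] : List ℕ).sum => seaRel [a] [a] i j)
    fun i j => by
      have hi := i.2
      have hj := j.2
      simp only [List.sum_singleton] at hi hj
      exact ⟨fun _ => Or.inl ⟨hi, hj⟩, fun _ => Or.inl ⟨hi, hj⟩⟩
  rw [listIndex, h, List.sum_singleton]

theorem listIndex_cons_self [Infinite K] (a : ℕ) {l m : List ℕ} (h : l.sum = m.sum) :
    listIndex K (a :: l) (a :: m) = a + listIndex K l m := by
  have := listIndex_append (K := K) (l := [a]) (m := [a]) rfl h
  rwa [listIndex_singleton] at this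

theorem sameBlock_zero_cons (l : List ℕ) (i j : ℕ) : sameBlock (0 :: l) i j ↔ sameBlock l i j := by
  simp [sameBlock]

/-- Panyushev's reduction. -/
theorem listIndex_reduce [Infinite K] {d₁ d₂ u : ℕ} (hd : 0 < d₂) (hu : d₁ = 0 ∨ u = 0)
    {l m : List ℕ} (h : l.sum = u + d₂ + m.sum) :
    listIndex K ((d₁ + d₂) :: l) ((d₁ + d₂ + u + d₂) :: m) =
      listIndex K (d₁ :: l) (u :: (d₁ + d₂) :: m) := by
  have : Nonempty (Fin d₂) := ⟨⟨0, hd⟩⟩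
  -- The first upper block is `D₁ ⊕ D₂` and the remaining nodes form `Q`. The first lower block
  -- reaches `u + d₂` nodes into `Q`: the first `u` of them are `U`, the last `d₂` are identified
  -- with `D₂`.
  let w : Fin d₂ → Fin l.sum := fun e => ⟨u + e, by omega⟩
  have hw : ∀ q : Fin l.sum, q ∈ Set.range w ↔ u ≤ q ∧ q < u + d₂ := by
    intro q
    constructor
    · rintro ⟨e, rfl⟩
      simp [w]
    · intro hq
      exact ⟨⟨q - u, by omega⟩, Fin.ext (by simp [w]; omega)⟩
  rw [listIndex, relIndex_eq_of_injective (N := (Fin d₁ ⊕ Fin d₂) ⊕ Fin l.sum)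
    (Sum.elim (Sum.elim (fun i => i) fun i => d₁ + i) fun i => d₁ + d₂ + i),
    listIndex, relIndex_eq_of_injective (N := Fin d₁ ⊕ Fin l.sum)
    (Sum.elim (fun i => i) fun i => d₁ + i)]
  · apply IsReduction.relIndex_eq (w := w) (U := fun q => q < u)
    refine ⟨?_, fun _ _ _ => seaRel_trans, fun _ _ _ => seaRel_trans, ?_, ?_, ?_, ?_, ?_, ?_, ?_, ?_,
      ?_, ?_, ?_⟩
    · intro e e' hee
      simpa [w, Fin.ext_iff] using hee
    · have : ∀ i, i < d₁ + d₂ + l.sum →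
          seaRel ((d₁ + d₂) :: l) ((d₁ + d₂ + u + d₂) :: m) i i := fun i hi =>
        ⟨fun _ => sameBlock_refl (by simp; omega), fun _ => sameBlock_refl (by simp; omega)⟩
      rintro ((i | i) | i) <;> apply this <;> simp <;> omega
    · intro e
      simp [w]
    · rcases hu with rfl | rfl
      · exact Or.inl inferInstance
      · exact Or.inr (by simp)
    · have : ∀ i j, i < d₁ + d₂ → j < d₁ + d₂ →
          seaRel ((d₁ + d₂) :: l) ((d₁ + d₂ + u + d₂) :: m) i j := fun i j hi hj =>
        ⟨fun _ => Or.inl ⟨hi, hj⟩, fun _ => Or.inl (by omega)⟩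
      rintro (i | i) (j | j) <;> apply this <;> simp <;> omega
    · rintro (i | i) q ⟨h1, -⟩
      all_goals
        simp only [Sum.elim_inl, Sum.elim_inr] at h1
        have := h1 (by omega)
        rw [sameBlock_cons] at this
        omega
    · intro q d
      rw [hw]
      have : ∀ i, i < d₁ + d₂ → (seaRel ((d₁ + d₂) :: l) ((d₁ + d₂ + u + d₂) :: m)
          (d₁ + d₂ + q) i ↔ (q : ℕ) < u + d₂) := by
        intro i hi
        rw [seaRel, sameBlock_cons, sameBlock_cons]
        omega
      have h2 : (q : ℕ) < u ∨ u ≤ (q : ℕ) ∧ (q : ℕ) < u + d₂ ↔ (q : ℕ) < u + d₂ := by omega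
      rw [h2]
      rcases d with i | i <;> apply this <;> simp <;> omega
    · intro e q hq
      simp only [Sum.elim_inr, w]
      exact ⟨fun _ => by omega, fun _ => Or.inl (by omega)⟩
    · intro d d'
      simp only [Sum.elim_inl]
      rcases hu with rfl | rfl
      · exact d.elim0
      · refine ⟨fun _ => Or.inl ⟨d.2, d'.2⟩, fun _ => ?_⟩
        rw [sameBlock_zero_cons]
        exact Or.inl (by omega)
    · rintro d q ⟨h1, -⟩
      simp only [Sum.elim_inl, Sum.elim_inr] at h1
      have := h1 (by omega)
      rw [sameBlock_cons] at this
      omega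
    · intro q d
      rw [hw]
      simp only [Sum.elim_inl, Sum.elim_inr]
      rcases hu with rfl | rfl
      · exact d.elim0
      · rw [seaRel, sameBlock_zero_cons, sameBlock_cons, sameBlock_cons]
        omega
    · intro q q'
      rw [hw]
      simp only [Sum.elim_inr]
      rcases hu with rfl | rfl
      · simp only [seaRel, sameBlock_cons, Nat.sub_sub, zero_add, add_tsub_cancel_left]
        have e1 : ∀ q : ℕ, d₂ + q - (d₂ + u + d₂) = q - (u + d₂) := by omega
        simp only [e1]
        grind
      · simp only [seaRel, sameBlock_cons, Nat.sub_sub, add_zero, zero_add,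
          add_tsub_cancel_left]
        have e1 : ∀ q : ℕ, d₁ + d₂ + q - (d₁ + d₂ + d₂) = q - d₂ := by omega
        have e2 : ∀ q : ℕ, d₁ + q - (d₁ + d₂) = q - d₂ := by omega
        simp only [e1, e2]
        grind
  · rintro (i | i) (j | j) hij <;> simp [Fin.ext_iff] at hij ⊢ <;> omega
  · rintro (i | i) <;> simp <;> omega
  · simp
  · rintro ((i | i) | i) ((j | j) | j) hij <;> simp [Fin.ext_iff] at hij ⊢ <;> omega
  · rintro ((i | i) | i) <;> simp <;> omega
  · simp

theorem listIndex_zero_cons_left {l m : List ℕ} :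
    listIndex K (0 :: l) m = listIndex K l m := by
  refine relIndex_equiv (finCongr (by simp)) fun i j => ?_
  simp only [seaRel, sameBlock_zero_cons, finCongr_apply, Fin.val_cast]

theorem listIndex_zero_cons_right {l m : List ℕ} :
    listIndex K l (0 :: m) = listIndex K l m := by
  simp only [listIndex, seaRel, sameBlock_zero_cons]

end Lists

end SeaweedMeander

end

noncomputable section

namespace SeaweedMeander

open Module

/-! ### The index of a meander in terms of lists of block sizes -/

section Bridge

attribute [local instance 100] LieRing.ofAssociativeRing

theorem index_eq_index_iff {n : ℕ} (c : Composition n) (i j : Fin n) :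
    c.index i = c.index j ↔ sameBlock c.blocks i j := by
  rw [sameBlock_iff_take]
  constructor
  · intro h
    exact ⟨c.index i, ⟨c.sizeUpTo_index_le i, c.lt_sizeUpTo_index_succ i⟩,
      h ▸ ⟨c.sizeUpTo_index_le j, c.lt_sizeUpTo_index_succ j⟩⟩
  · rintro ⟨k, hi, hj⟩
    have key : ∀ i : Fin n, c.sizeUpTo k ≤ i → (i : ℕ) < c.sizeUpTo (k + 1) →
        (c.index i : ℕ) = k := by
      intro i h1 h2
      have h3 := c.sizeUpTo_index_le i
      have h4 := c.lt_sizeUpTo_index_succ i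
      apply le_antisymm
      · by_contra! hlt
        have := c.monotone_sizeUpTo (show k + 1 ≤ c.index i from hlt)
        omega
      · by_contra! hlt
        have : c.sizeUpTo (c.index i).succ ≤ c.sizeUpTo k :=
          c.monotone_sizeUpTo (by simpa using hlt)
        omega
    exact Fin.ext ((key i hi.1 hi.2).trans (key j hj.1 hj.2).symm)

theorem hasShape_iff {K : Type*} [Field K] {n : ℕ} (M : Meander n) (A : Matrix (Fin n) (Fin n) K) :
    HasShape M A ↔ A ∈ shape K fun i j : Fin n => seaRel M.top.blocks M.bot.blocks i j := by
  simp only [HasShape, mem_shape, seaRel, index_eq_index_iff]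
  rfl

theorem finrank_coadjointStabilizer {n : ℕ} (M : Meander n)
    (f : Dual ℂ (Matrix (Fin n) (Fin n) ℂ)) :
    finrank ℂ (coadjointStabilizer (K := ℂ) (L := seaweed ℂ M)
      (f ∘ₗ (seaweed ℂ M).toSubmodule.subtype)) =
      stabDim (fun i j : Fin n => seaRel M.top.blocks M.bot.blocks i j) f := by
  refine finrank_eq_of_map_eq (seaweed ℂ M).toSubmodule.subtype (fun x _ hx => Subtype.ext hx) ?_
  ext x
  constructor
  · rintro ⟨⟨x, hx⟩, h, rfl⟩
    exact ⟨(hasShape_iff M x).1 hx, fun y hy => h ⟨y, (hasShape_iff M y).2 hy⟩⟩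
  · rintro ⟨hx, h⟩
    exact ⟨⟨x, (hasShape_iff M x).2 hx⟩, fun y => h y.1 ((hasShape_iff M y.1).1 y.2), rfl⟩

/-- Minimizing over forms on the seaweed algebra or over forms on all matrices is the same, since
every form on a subspace extends. -/
theorem index_eq_listIndex {n : ℕ} (M : Meander n) :
    M.index = listIndex ℂ M.top.blocks M.bot.blocks := by
  have h1 : listIndex ℂ M.top.blocks M.bot.blocks =
      relIndex ℂ fun i j : Fin n => seaRel M.top.blocks M.bot.blocks i j :=
    relIndex_equiv (finCongr M.top.blocks_sum) fun i j => Iff.rfl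
  rw [h1]
  apply le_antisymm
  · refine le_relIndex fun f => ?_
    rw [← finrank_coadjointStabilizer]
    exact ciInf_le' _ _
  · refine le_ciInf fun φ => ?_
    obtain ⟨f, rfl⟩ := LinearMap.exists_extend (p := (seaweed ℂ M).toSubmodule) φ
    exact (relIndex_le _ f).trans_eq (finrank_coadjointStabilizer M f).symm

end Bridge

/-! ### Homogeneity of the index -/

section Scaling

variable {K : Type*} [Field K] [Infinite K]

/-- Deletion of zero blocks, removal of equal first blocks and Panyushev's reduction all commute
with scaling, and together they reduce any pair to the empty one. -/
theorem listIndex_map_mul {c : ℕ} (hc : 0 < c) {l m : List ℕ} (h : l.sum = m.sum) :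
    listIndex K (l.map (c * ·)) (m.map (c * ·)) = c * listIndex K l m := by
  have hsum : ∀ l : List ℕ, (l.map (c * ·)).sum = c * l.sum := fun l => by
    simpa using List.sum_map_mul_left l id c
  -- The reduction lowers the sum by `d₂ ≥ 1` but adds one block, possibly of size zero; the factor
  -- `2` makes the measure decrease nevertheless.
  obtain ⟨n, hn⟩ : ∃ n, 2 * l.sum + l.length + m.length ≤ n := ⟨_, le_rfl⟩
  induction n generalizing l m with
  | zero =>
    obtain rfl : l = [] := List.length_eq_zero_iff.1 (by omega)
    obtain rfl : m = [] := List.length_eq_zero_iff.1 (by omega)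
    simp [listIndex_nil]
  | succ n ih =>
    have red : ∀ (a b : ℕ) (l m : List ℕ), 0 < a → a < b → a + l.sum = b + m.sum →
        2 * (a + l.sum) + (l.length + 1) + (m.length + 1) ≤ n + 1 →
        listIndex K ((a :: l).map (c * ·)) ((b :: m).map (c * ·)) =
          c * listIndex K (a :: l) (b :: m) := by
      intro a b l m ha hab hs hlen
      -- The two shapes of the reduction are `2a ≤ b`, with `d₁ = 0`, and `2a ≥ b`, with `u = 0`.
      obtain ⟨d₁, d₂, u, hd, hu, rfl, rfl⟩ : ∃ d₁ d₂ u, 0 < d₂ ∧ (d₁ = 0 ∨ u = 0) ∧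
          a = d₁ + d₂ ∧ b = d₁ + d₂ + u + d₂ := by
        rcases le_total (2 * a) b with h2 | h2
        · exact ⟨0, a, b - 2 * a, ha, Or.inl rfl, by omega, by omega⟩
        · exact ⟨2 * a - b, b - a, 0, by omega, Or.inr rfl, by omega, by omega⟩
      rw [listIndex_reduce hd hu (by omega), ← ih (by simp; omega) (by simp; omega)]
      simp only [List.map_cons, mul_add]
      refine listIndex_reduce (Nat.mul_pos hc hd) (hu.imp ?_ ?_) ?_
      · rintro rfl
        rfl
      · rintro rfl
        rfl
      · rw [hsum, hsum, ← mul_add, ← mul_add]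
        congr 1
        omega
    rcases l with _ | ⟨a, l⟩
    · rcases m with _ | ⟨b, m⟩
      · simp [listIndex_nil]
      · simp only [List.sum_nil, List.sum_cons] at h
        obtain rfl : b = 0 := by omega
        rw [List.map_cons, mul_zero, listIndex_zero_cons_right, listIndex_zero_cons_right]
        exact ih (by simp; omega) (by simp at hn ⊢; omega)
    · rcases m with _ | ⟨b, m⟩
      · simp only [List.sum_nil, List.sum_cons] at h
        obtain rfl : a = 0 := by omega
        rw [List.map_cons, mul_zero, listIndex_zero_cons_left, listIndex_zero_cons_left]
        exact ih (by simp; omega) (by simp at hn ⊢; omega)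
      · simp only [List.sum_cons, List.length_cons] at h hn
        rcases Nat.eq_zero_or_pos a with rfl | ha
        · rw [List.map_cons, mul_zero, listIndex_zero_cons_left, listIndex_zero_cons_left]
          exact ih (by simp; omega) (by simp; omega)
        rcases Nat.eq_zero_or_pos b with rfl | hb
        · rw [List.map_cons (l := m), mul_zero, listIndex_zero_cons_right,
            listIndex_zero_cons_right]
          exact ih (by simp; omega) (by simp; omega)
        rcases lt_trichotomy a b with hab | rfl | hab
        · exact red a b l m ha hab h (by omega)
        · have h' : l.sum = m.sum := by omega
          rw [List.map_cons, List.map_cons, listIndex_cons_self a h',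
            listIndex_cons_self _ (by rw [hsum, hsum, h']), ih h' (by omega), mul_add]
        · rw [listIndex_comm (by rw [hsum, hsum]; simp [h]),
            listIndex_comm (l := a :: l) (by simpa using h)]
          exact red b a m l hb hab h.symm (by omega)

end Scaling

end SeaweedMeander

end

noncomputable section

namespace SeaweedMeander

open MvPowerSeries

/-! ### Generating functions -/

section GeneratingFunctions

variable {α β : Type*}

/-- The generating function of a weighted set with finite fibres. -/
def genFun (S : Set α) (wt : α → Fin 2 →₀ ℕ) : MvPowerSeries (Fin 2) ℚ :=
  fun e => ({a ∈ S | wt a = e}.ncard : ℚ)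

theorem coeff_genFun (S : Set α) (wt : α → Fin 2 →₀ ℕ) (e : Fin 2 →₀ ℕ) :
    coeff e (genFun S wt) = ({a ∈ S | wt a = e}.ncard : ℚ) := rfl

theorem genFun_union {S T : Set α} {wt : α → Fin 2 →₀ ℕ} (h : Disjoint S T)
    (hS : ∀ e, {a ∈ S | wt a = e}.Finite) (hT : ∀ e, {a ∈ T | wt a = e}.Finite) :
    genFun (S ∪ T) wt = genFun S wt + genFun T wt := by
  ext e
  rw [map_add, coeff_genFun, coeff_genFun, coeff_genFun, ← Nat.cast_add, ← Set.ncard_union_eq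
    (h.mono (fun _ ha => ha.1) (fun _ ha => ha.1)) (hS e) (hT e)]
  congr 2
  ext a
  simp only [Set.mem_ofPred_eq, Set.mem_union]
  tauto

theorem genFun_image {S : Set β} {wt : α → Fin 2 →₀ ℕ} (φ : β → α) (hφ : Set.InjOn φ S) :
    genFun (φ '' S) wt = genFun S (fun b => wt (φ b)) := by
  ext e
  rw [coeff_genFun, coeff_genFun, ← (hφ.mono fun _ ha => ha.1).ncard_image]
  congr 2
  ext a
  constructor
  · rintro ⟨⟨b, hb, rfl⟩, h⟩
    exact ⟨b, ⟨hb, h⟩, rfl⟩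
  · rintro ⟨b, ⟨hb, h⟩, rfl⟩
    exact ⟨⟨b, hb, rfl⟩, h⟩

theorem genFun_congr {S : Set α} {wt wt' : α → Fin 2 →₀ ℕ} (h : ∀ a ∈ S, wt a = wt' a) :
    genFun S wt = genFun S wt' := by
  ext e
  rw [coeff_genFun, coeff_genFun]
  congr 2
  ext a
  simp only [Set.mem_ofPred_eq]
  exact and_congr_right fun ha => by rw [h a ha]

theorem genFun_shift {S : Set α} {wt : α → Fin 2 →₀ ℕ} (d : Fin 2 →₀ ℕ) :
    genFun S (fun a => wt a + d) = monomial d 1 * genFun S wt := by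
  ext e
  rw [coeff_monomial_mul, coeff_genFun]
  split_ifs with h
  · rw [one_mul, coeff_genFun]
    congr 2
    ext a
    simp only [Set.mem_ofPred_eq]
    exact and_congr_right fun _ => (eq_tsub_iff_add_eq_of_le h).symm
  · rw [Nat.cast_eq_zero]
    convert Set.ncard_empty α
    ext a
    simp only [Set.mem_ofPred_eq, Set.mem_empty_iff_false, iff_false, not_and]
    rintro - rfl
    exact h le_add_self

theorem genFun_singleton {a : α} {wt : α → Fin 2 →₀ ℕ} (h : wt a = 0) : genFun {a} wt = 1 := by
  ext e
  rw [coeff_genFun, coeff_one]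
  split_ifs with he
  · rw [Nat.cast_eq_one, Set.ncard_eq_one]
    refine ⟨a, ?_⟩
    ext b
    simp only [Set.mem_ofPred_eq, Set.mem_singleton_iff, and_iff_left_iff_imp]
    rintro rfl
    rw [h, he]
  · rw [Nat.cast_eq_zero]
    convert Set.ncard_empty α
    ext b
    simp only [Set.mem_ofPred_eq, Set.mem_singleton_iff, Set.mem_empty_iff_false, iff_false, not_and]
    rintro rfl h'
    exact he (h'.symm.trans h)

/-- The finiteness hypotheses are needed because `ncard` counts infinite sets as `0`. -/
theorem genFun_prod {S : Set α} {T : Set β} {wt : α → Fin 2 →₀ ℕ} {wt' : β → Fin 2 →₀ ℕ}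
    (hS : ∀ e, {a ∈ S | wt a = e}.Finite) (hT : ∀ e, {a ∈ T | wt' a = e}.Finite) :
    genFun (S ×ˢ T) (fun p => wt p.1 + wt' p.2) = genFun S wt * genFun T wt' := by
  classical
  ext e
  rw [coeff_mul, coeff_genFun]
  simp only [coeff_genFun, ← Nat.cast_mul, ← Nat.cast_sum]
  congr 1
  have h1 : {p ∈ S ×ˢ T | wt p.1 + wt' p.2 = e} =
      ((Finset.HasAntidiagonal.antidiagonal e).biUnion fun d =>
        (hS d.1).toFinset ×ˢ (hT d.2).toFinset : Finset (α × β)) := by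
    ext ⟨a, b⟩
    simp
    grind
  rw [h1, Set.ncard_coe_finset, Finset.card_biUnion]
  · refine Finset.sum_congr rfl fun d _ => ?_
    rw [Finset.card_product, Set.ncard_eq_toFinset_card _ (hS d.1),
      Set.ncard_eq_toFinset_card _ (hT d.2)]
  · intro d _ d' _ hne
    rw [Function.onFun, Finset.disjoint_left]
    rintro ⟨a, b⟩ h2 h3
    simp at h2 h3
    exact hne (Prod.ext (h2.1.2.symm.trans h3.1.2) (h2.2.2.symm.trans h3.2.2))

end GeneratingFunctions

/-! ### Generating functions of meanders with prescribed beginnings -/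

section Pairs

/-- The exponent of `x ^ n * y ^ k`. -/
def expo (n k : ℕ) : Fin 2 →₀ ℕ := Finsupp.single 0 n + Finsupp.single 1 k

theorem expo_zero (n k : ℕ) : expo n k 0 = n := by simp [expo]

theorem expo_one (n k : ℕ) : expo n k 1 = k := by simp [expo]

theorem expo_eq_iff {n k : ℕ} {e : Fin 2 →₀ ℕ} : expo n k = e ↔ n = e 0 ∧ k = e 1 := by
  constructor
  · rintro rfl
    rw [expo_zero, expo_one]
    exact ⟨rfl, rfl⟩
  · rintro ⟨rfl, rfl⟩
    ext i
    fin_cases i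
    · exact expo_zero _ _
    · exact expo_one _ _

theorem expo_add (n k n' k' : ℕ) : expo (n + n') (k + k') = expo n k + expo n' k' := by
  rw [expo_eq_iff]
  simp [expo_zero, expo_one]

theorem monomial_expo (n k : ℕ) :
    monomial (expo n k) (1 : ℚ) = (X 0 : MvPowerSeries (Fin 2) ℚ) ^ n * X 1 ^ k := by
  rw [X_pow_eq, X_pow_eq, monomial_mul_monomial, one_mul]
  rfl

/-- All entries of both lists belong to `J`. -/
def PairIn (J : Set ℕ) (p : List ℕ × List ℕ) : Prop := (∀ a ∈ p.1, a ∈ J) ∧ ∀ a ∈ p.2, a ∈ J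

/-- The pairs of lists with entries in `J` which complete the given beginnings to a pair of lists
of the same sum. -/
def completions (J : Set ℕ) (s t : List ℕ) : Set (List ℕ × List ℕ) :=
  {p | PairIn J p ∧ (s ++ p.1).sum = (t ++ p.2).sum}

/-- The size and the index of a pair of lists. -/
def pairWeight (p : List ℕ × List ℕ) : Fin 2 →₀ ℕ := expo p.1.sum (listIndex ℂ p.1 p.2)

/-- The generating function of the pairs of lists with given beginnings. -/
def prefixSeries (J : Set ℕ) (s t : List ℕ) : MvPowerSeries (Fin 2) ℚ :=
  genFun (completions J s t) fun p => pairWeight (s ++ p.1, t ++ p.2)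

theorem eq_nil_of_sum_eq_zero {J : Set ℕ} (hJ : 0 ∉ J) {l : List ℕ} (hl : ∀ a ∈ l, a ∈ J)
    (h : l.sum = 0) : l = [] := by
  rw [List.eq_nil_iff_forall_not_mem]
  intro a ha
  rw [List.sum_eq_zero_iff] at h
  exact hJ (h a ha ▸ hl a ha)

theorem finite_lists {J : Set ℕ} (hJ : 0 ∉ J) (n : ℕ) :
    {l : List ℕ | (∀ a ∈ l, a ∈ J) ∧ l.sum = n}.Finite := by
  refine (Set.finite_range fun c : Composition n => c.blocks).subset ?_
  rintro l ⟨h, rfl⟩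
  exact ⟨⟨l, fun {a} ha => Nat.pos_of_ne_zero fun h0 => hJ (h0 ▸ h a ha), rfl⟩, rfl⟩

theorem finite_completions {J : Set ℕ} (hJ : 0 ∉ J) (s t : List ℕ) (e : Fin 2 →₀ ℕ) :
    {p ∈ completions J s t | pairWeight (s ++ p.1, t ++ p.2) = e}.Finite := by
  refine ((finite_lists hJ (e 0 - s.sum)).prod (finite_lists hJ (e 0 - t.sum))).subset ?_
  rintro ⟨l, m⟩ ⟨⟨⟨h1, h2⟩, h3⟩, h4⟩
  rw [pairWeight, expo_eq_iff] at h4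
  simp only [List.sum_append] at h3 h4
  exact ⟨⟨h1, by simp; omega⟩, ⟨h2, by simp; omega⟩⟩

theorem prefixSeries_comm (J : Set ℕ) (s t : List ℕ) :
    prefixSeries J s t = prefixSeries J t s := by
  have h : completions J t s = Prod.swap '' completions J s t := by
    ext ⟨l, m⟩
    constructor
    · rintro ⟨⟨h1, h2⟩, h3⟩
      exact ⟨(m, l), ⟨⟨h2, h1⟩, h3.symm⟩, rfl⟩
    · rintro ⟨⟨l, m⟩, ⟨⟨h1, h2⟩, h3⟩, h⟩
      cases h
      exact ⟨⟨h2, h1⟩, h3.symm⟩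
  rw [prefixSeries, prefixSeries, h, genFun_image _ Prod.swap_injective.injOn]
  refine genFun_congr ?_
  rintro ⟨l, m⟩ ⟨-, h⟩
  simp only [pairWeight, Prod.fst_swap, Prod.snd_swap]
  rw [listIndex_comm h, h]

/-- Turns a rule for the index that holds for every continuation into a relation between series: the
change of beginning costs `a` nodes and `b` units of index. -/
theorem prefixSeries_shift (J : Set ℕ) {s t s' t' : List ℕ} (a b : ℕ) (hs : s.sum = s'.sum + a)
    (ht : t.sum = t'.sum + a)
    (h : ∀ l m, (s' ++ l).sum = (t' ++ m).sum →
      listIndex ℂ (s ++ l) (t ++ m) = listIndex ℂ (s' ++ l) (t' ++ m) + b) :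
    prefixSeries J s t = X 0 ^ a * X 1 ^ b * prefixSeries J s' t' := by
  have hc : completions J s t = completions J s' t' := by
    ext p
    simp only [completions, Set.mem_ofPred_eq, List.sum_append]
    refine and_congr_right fun _ => ?_
    omega
  rw [prefixSeries, prefixSeries, ← monomial_expo, ← genFun_shift, hc]
  refine genFun_congr ?_
  rintro ⟨l, m⟩ ⟨-, hlm⟩
  simp only [pairWeight]
  rw [← expo_add, h l m hlm]
  congr 1
  simp only [List.sum_append]
  omega

theorem zero_notMem_one_two_three : (0 : ℕ) ∉ ({1, 2, 3} : Set ℕ) := by simp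

theorem genFun_cons (a : ℕ) (t : List ℕ) :
    genFun ((fun p : List ℕ × List ℕ => (a :: p.1, p.2)) '' completions {1, 2, 3} [a] t)
      (fun p => pairWeight ([] ++ p.1, t ++ p.2)) = prefixSeries {1, 2, 3} [a] t := by
  rw [genFun_image]
  · rfl
  · rintro ⟨l, m⟩ - ⟨l', m'⟩ - h
    simpa using h

theorem image_cons_subset {J : Set ℕ} {a : ℕ} (ha : a ∈ J) (t : List ℕ) :
    (fun p : List ℕ × List ℕ => (a :: p.1, p.2)) '' completions J [a] t ⊆
      completions J [] t := by
  rintro _ ⟨⟨l, m⟩, ⟨⟨h1, h2⟩, h3⟩, rfl⟩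
  exact ⟨⟨List.forall_mem_cons.2 ⟨ha, h1⟩, h2⟩, h3⟩

theorem finite_of_subset {J : Set ℕ} (hJ : 0 ∉ J) {s t : List ℕ} {S : Set (List ℕ × List ℕ)}
    (hS : S ⊆ completions J s t) (e : Fin 2 →₀ ℕ) :
    {p ∈ S | pairWeight (s ++ p.1, t ++ p.2) = e}.Finite :=
  (finite_completions hJ s t e).subset fun _ hp => ⟨hS hp.1, hp.2⟩

theorem genFun_nonempty (t : List ℕ) :
    genFun {p ∈ completions {1, 2, 3} [] t | p.1 ≠ []}
      (fun p => pairWeight ([] ++ p.1, t ++ p.2)) =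
      prefixSeries {1, 2, 3} [1] t + prefixSeries {1, 2, 3} [2] t + prefixSeries {1, 2, 3} [3] t := by
  let S : ℕ → Set (List ℕ × List ℕ) := fun a =>
    (fun p : List ℕ × List ℕ => (a :: p.1, p.2)) '' completions {1, 2, 3} [a] t
  have h : {p ∈ completions {1, 2, 3} [] t | p.1 ≠ []} = S 1 ∪ S 2 ∪ S 3 := by
    ext ⟨l, m⟩
    constructor
    · rintro ⟨⟨⟨h1, h2⟩, h3⟩, h4⟩
      rcases l with _ | ⟨a, l⟩
      · exact absurd rfl h4
      · obtain ⟨ha, hl⟩ := List.forall_mem_cons.1 h1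
        rcases ha with rfl | rfl | rfl
        · exact Or.inl (Or.inl ⟨(l, m), ⟨⟨hl, h2⟩, h3⟩, rfl⟩)
        · exact Or.inl (Or.inr ⟨(l, m), ⟨⟨hl, h2⟩, h3⟩, rfl⟩)
        · exact Or.inr ⟨(l, m), ⟨⟨hl, h2⟩, h3⟩, rfl⟩
    · intro hp
      refine ⟨?_, ?_⟩
      · rcases hp with (hp | hp) | hp
        · exact image_cons_subset (by simp) t hp
        · exact image_cons_subset (by simp) t hp
        · exact image_cons_subset (by simp) t hp
      · rcases hp with (⟨p, -, hp⟩ | ⟨p, -, hp⟩) | ⟨p, -, hp⟩ <;> cases hp <;> simp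
  have hd : ∀ a b, a ≠ b → Disjoint (S a) (S b) := by
    intro a b hab
    rw [Set.disjoint_left]
    rintro _ ⟨p, -, rfl⟩ ⟨q, -, h⟩
    simp only [Prod.mk.injEq, List.cons.injEq] at h
    exact hab h.1.1.symm
  have hf : ∀ a ∈ ({1, 2, 3} : Set ℕ), S a ⊆ completions {1, 2, 3} [] t := fun a ha =>
    image_cons_subset ha t
  have h0 := zero_notMem_one_two_three
  rw [h, genFun_union ((hd 1 3 (by simp)).union_left (hd 2 3 (by simp)))
    (finite_of_subset h0 (Set.union_subset (hf 1 (by simp)) (hf 2 (by simp))))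
    (finite_of_subset h0 (hf 3 (by simp))), genFun_union (hd 1 2 (by simp))
    (finite_of_subset h0 (hf 1 (by simp))) (finite_of_subset h0 (hf 2 (by simp))),
    genFun_cons, genFun_cons, genFun_cons]

/-- Case distinction on the first upper part, which exists because the lower composition is
nonempty. -/
theorem prefixSeries_split {t : List ℕ} (ht : 0 < t.sum) :
    prefixSeries {1, 2, 3} [] t =
      prefixSeries {1, 2, 3} [1] t + prefixSeries {1, 2, 3} [2] t + prefixSeries {1, 2, 3} [3] t := by
  rw [← genFun_nonempty, prefixSeries]
  congr 1
  ext ⟨l, m⟩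
  refine (and_iff_left_of_imp ?_).symm
  rintro ⟨-, h⟩ h'
  simp only at h'
  subst h'
  simp only [List.append_nil, List.sum_nil, List.sum_append] at h
  omega

theorem prefixSeries_nil_nil {J : Set ℕ} (hJ : 0 ∉ J) :
    prefixSeries J [] [] = 1 + genFun {p ∈ completions J [] [] | p.1 ≠ []} pairWeight := by
  have h : completions J [] [] = {([], [])} ∪ {p ∈ completions J [] [] | p.1 ≠ []} := by
    ext ⟨l, m⟩
    constructor
    · intro h
      by_cases hl : l = []
      · subst hl
        left
        have hm : m = [] := eq_nil_of_sum_eq_zero hJ h.1.2 h.2.symm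
        rw [hm]
        rfl
      · exact Or.inr ⟨h, hl⟩
    · rintro (h | h)
      · cases h
        exact ⟨⟨by simp, by simp⟩, rfl⟩
      · exact h.1
  have hw : pairWeight ([], []) = 0 := by
    rw [pairWeight, listIndex_nil, expo_eq_iff]
    exact ⟨rfl, rfl⟩
  rw [prefixSeries, h, genFun_union, genFun_singleton]
  · rw [← h]
    rfl
  · exact hw
  · rw [Set.disjoint_left]
    rintro _ rfl ⟨-, h⟩
    exact h rfl
  · exact fun e => (Set.finite_singleton _).subset fun _ h => h.1
  · exact finite_of_subset hJ fun _ h => h.1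

theorem prefixSeries_nil_nil_split :
    prefixSeries {1, 2, 3} [] [] = 1 + (prefixSeries {1, 2, 3} [1] [] +
      prefixSeries {1, 2, 3} [2] [] + prefixSeries {1, 2, 3} [3] []) := by
  rw [← genFun_nonempty, prefixSeries_nil_nil zero_notMem_one_two_three]
  rfl

end Pairs

/-! ### The linear system for parts 1, 2, 3 -/

section Equations

theorem listIndex_one_two {l m : List ℕ} (h : l.sum = 1 + m.sum) :
    listIndex ℂ (1 :: l) (2 :: m) = listIndex ℂ l (1 :: m) := by
  have := listIndex_reduce (K := ℂ) (d₁ := 0) (d₂ := 1) (u := 0) one_pos (Or.inl rfl)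
    (l := l) (m := m) (by omega)
  rwa [listIndex_zero_cons_left, listIndex_zero_cons_right] at this

theorem listIndex_one_three {l m : List ℕ} (h : l.sum = 2 + m.sum) :
    listIndex ℂ (1 :: l) (3 :: m) = listIndex ℂ l (1 :: 1 :: m) := by
  have := listIndex_reduce (K := ℂ) (d₁ := 0) (d₂ := 1) (u := 1) one_pos (Or.inl rfl)
    (l := l) (m := m) (by omega)
  rwa [listIndex_zero_cons_left] at this

theorem listIndex_two_three {l m : List ℕ} (h : l.sum = 1 + m.sum) :
    listIndex ℂ (2 :: l) (3 :: m) = listIndex ℂ (1 :: l) (2 :: m) := by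
  have := listIndex_reduce (K := ℂ) (d₁ := 1) (d₂ := 1) (u := 0) one_pos (Or.inr rfl)
    (l := l) (m := m) (by omega)
  rwa [listIndex_zero_cons_right] at this

variable (J : Set ℕ) (s t : List ℕ)

theorem prefixSeries_cons_self (a : ℕ) :
    prefixSeries J (a :: s) (a :: t) = X 0 ^ a * X 1 ^ a * prefixSeries J s t :=
  prefixSeries_shift J a a (by simp [add_comm]) (by simp [add_comm]) fun l m h => by
    rw [List.cons_append, List.cons_append, listIndex_cons_self _ h, add_comm]

theorem prefixSeries_one_two :
    prefixSeries J (1 :: s) [2] = X 0 * prefixSeries J s [1] := by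
  rw [prefixSeries_shift J (s' := s) (t' := [1]) 1 0 (by simp [add_comm]) (by simp)]
  · simp
  · intro l m h
    exact listIndex_one_two (by simpa using h)

theorem prefixSeries_one_three :
    prefixSeries J (1 :: s) [3] = X 0 * prefixSeries J s [1, 1] := by
  rw [prefixSeries_shift J (s' := s) (t' := [1, 1]) 1 0 (by simp [add_comm]) (by simp)]
  · simp
  · intro l m h
    exact listIndex_one_three (by simp at h ⊢; omega)

theorem prefixSeries_two_three :
    prefixSeries J [2] [3] = X 0 * prefixSeries J [1] [2] := by
  rw [prefixSeries_shift J (s' := [1]) (t' := [2]) 1 0 (by simp) (by simp)]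
  · simp
  · intro l m h
    exact listIndex_two_three (by simp at h ⊢; omega)

/-- The generating function of meanders with parts in `{1, 2, 3}` up to denominators. -/
theorem prefixSeries_equation {x y : MvPowerSeries (Fin 2) ℚ} (hx : x = X 0) (hy : y = X 1) :
    prefixSeries {1, 2, 3} [] [] *
      ((1 - x - x ^ 2 * y - x ^ 3 * y) * (1 - x * y - x ^ 2 * y ^ 2 - x ^ 3 * y ^ 3) -
            (2 * x ^ 2 * y + 4 * x ^ 3 * y + 2 * x ^ 3 * y ^ 2 + 2 * x ^ 4 * y ^ 2 +
              2 * x ^ 5 * y)) = 1 - x - x ^ 2 * y - x ^ 3 * y := by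
  have e0 := prefixSeries_nil_nil_split
  rw [prefixSeries_comm _ [1] [], prefixSeries_comm _ [2] [], prefixSeries_comm _ [3] [],
    prefixSeries_split (t := [2]) (by simp), prefixSeries_split (t := [3]) (by simp),
    prefixSeries_comm _ [3] [2], prefixSeries_cons_self, prefixSeries_cons_self,
    prefixSeries_two_three, prefixSeries_one_two, prefixSeries_one_three, ← hx, ← hy] at e0
  have e1 := prefixSeries_split (t := [1]) (by simp)
  rw [prefixSeries_comm _ [2] [1], prefixSeries_comm _ [3] [1], prefixSeries_cons_self,
    prefixSeries_one_two, prefixSeries_one_three, ← hx, ← hy] at e1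
  have e2 := prefixSeries_split (t := [1, 1]) (by simp)
  rw [prefixSeries_comm _ [2] [1, 1], prefixSeries_comm _ [3] [1, 1], prefixSeries_cons_self,
    prefixSeries_one_two, prefixSeries_one_three, prefixSeries_cons_self, prefixSeries_cons_self,
    ← hx, ← hy] at e2
  generalize prefixSeries {1, 2, 3} [] [] = A at *
  generalize prefixSeries {1, 2, 3} [] [1] = B at *
  generalize prefixSeries {1, 2, 3} [] [1, 1] = C at *
  -- Adding `x * e2` eliminates `C` from `e0` and `e1`. The latter becomes `(1 - x - x²y - x³y) B =
  -- (xy + x³y) A`, and the second factor is the coefficient of `B` in the former.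
  linear_combination (1 - x - x ^ 2 * y - x ^ 3 * y) * (e0 + x * e2) +
    (1 + x + 2 * x ^ 2 + x ^ 2 * y + x ^ 3 * y) * (e1 + x * e2)

end Equations

end SeaweedMeander

end

noncomputable section

namespace SeaweedMeander

open MvPowerSeries

/-! ### Unique factorization into indecomposables -/

section Decomposition

/-- The pair of lists is a direct sum of two strictly smaller pairs. -/
def PairDecomposable (p : List ℕ × List ℕ) : Prop :=
  ∃ q q' : List ℕ × List ℕ, q.1.sum = q.2.sum ∧ q'.1.sum = q'.2.sum ∧
    q.1.sum < p.1.sum ∧ q'.1.sum < p.1.sum ∧ p = (q.1 ++ q'.1, q.2 ++ q'.2)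

/-- The nonempty indecomposable pairs of lists with entries in `J`. -/
def indecomposables (J : Set ℕ) : Set (List ℕ × List ℕ) :=
  {p ∈ completions J [] [] | 0 < p.1.sum ∧ ¬ PairDecomposable p}

theorem indecomposables_subset (J : Set ℕ) : indecomposables J ⊆ completions J [] [] :=
  fun _ h => h.1

theorem pairIn_append {J : Set ℕ} {q q' : List ℕ × List ℕ} :
    PairIn J (q.1 ++ q'.1, q.2 ++ q'.2) ↔ PairIn J q ∧ PairIn J q' := by
  simp only [PairIn, List.forall_mem_append]
  tauto

theorem exists_indecomposable_append {J : Set ℕ} {p : List ℕ × List ℕ}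
    (hp : p ∈ completions J [] []) (h0 : 0 < p.1.sum) :
    ∃ q ∈ indecomposables J, ∃ q' ∈ completions J [] [], p = (q.1 ++ q'.1, q.2 ++ q'.2) := by
  induction hn : p.1.sum using Nat.strong_induction_on generalizing p with
  | _ n ih =>
    by_cases hd : PairDecomposable p
    · obtain ⟨q, q', h1, h2, h3, h4, rfl⟩ := hd
      obtain ⟨hq, hq'⟩ := pairIn_append.1 hp.1
      have hs : q.1.sum + q'.1.sum = n := by simpa using hn
      simp only [List.sum_append] at h3 h4
      obtain ⟨u, hu, u', hu', rfl⟩ := ih q.1.sum (by omega) (p := q) ⟨hq, h1⟩ (by omega) rfl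
      refine ⟨u, hu, (u'.1 ++ q'.1, u'.2 ++ q'.2), ⟨pairIn_append.2 ⟨hu'.1, hq'⟩, ?_⟩, by simp⟩
      have := hu'.2
      simp at this ⊢
      omega
    · exact ⟨p, ⟨hp, h0, hd⟩, ([], []), ⟨by simp [PairIn], rfl⟩, by simp⟩

theorem eq_append_of_append_eq {J : Set ℕ} (hJ : 0 ∉ J) {l l' m m' : List ℕ}
    (hl : ∀ a ∈ l, a ∈ J) (h : l ++ l' = m ++ m') (hs : l.sum ≤ m.sum) : ∃ k, m = l ++ k := by
  rcases List.append_eq_append_iff.1 h with ⟨k, hk, -⟩ | ⟨k, hk, -⟩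
  · exact ⟨k, hk⟩
  · subst hk
    rw [List.sum_append] at hs
    refine ⟨[], ?_⟩
    rw [eq_nil_of_sum_eq_zero hJ (fun a ha => hl a (List.mem_append_right _ ha)) (by omega)]
    simp

/-- The direct sum of two pairs of lists. -/
def pairAppend (p : (List ℕ × List ℕ) × (List ℕ × List ℕ)) : List ℕ × List ℕ :=
  (p.1.1 ++ p.2.1, p.1.2 ++ p.2.2)

theorem nonempty_eq_image_pairAppend {J : Set ℕ} (hJ : 0 ∉ J) :
    {p ∈ completions J [] [] | p.1 ≠ []} =
      pairAppend '' (indecomposables J ×ˢ completions J [] []) := by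
  ext p
  constructor
  · rintro ⟨hp, hne⟩
    have h0 : 0 < p.1.sum :=
      Nat.pos_of_ne_zero fun h => hne (eq_nil_of_sum_eq_zero hJ hp.1.1 h)
    obtain ⟨q, hq, q', hq', rfl⟩ := exists_indecomposable_append hp h0
    exact ⟨(q, q'), ⟨hq, hq'⟩, rfl⟩
  · rintro ⟨⟨q, q'⟩, ⟨hq, hq'⟩, rfl⟩
    refine ⟨⟨pairIn_append.2 ⟨hq.1.1, hq'.1⟩, ?_⟩, ?_⟩
    · have h1 : q.1.sum = q.2.sum := hq.1.2
      have h2 : q'.1.sum = q'.2.sum := hq'.2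
      simp [pairAppend, h1, h2]
    · intro h
      have h1 : q.1 = [] := (List.append_eq_nil_iff.1 h).1
      have h2 : 0 < q.1.sum := hq.2.1
      simp [h1] at h2

/-- The shorter first summand is a beginning of the longer one, in both rows; a proper beginning
would decompose the longer one. Excluding zero parts makes a remainder of sum zero empty. -/
theorem eq_of_append_eq {J : Set ℕ} (hJ : 0 ∉ J) {q u q' u' : List ℕ × List ℕ}
    (hq : q ∈ indecomposables J) (hu : u ∈ indecomposables J) (heq₁ : q.1 ++ q'.1 = u.1 ++ u'.1)
    (heq₂ : q.2 ++ q'.2 = u.2 ++ u'.2) (hle : q.1.sum ≤ u.1.sum) : q = u := by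
  have e1 : q.1.sum = q.2.sum := hq.1.2
  have e2 : u.1.sum = u.2.sum := hu.1.2
  obtain ⟨k₁, hk₁⟩ := eq_append_of_append_eq hJ hq.1.1.1 heq₁ hle
  obtain ⟨k₂, hk₂⟩ := eq_append_of_append_eq hJ hq.1.1.2 heq₂ (by omega)
  have s1 : u.1.sum = q.1.sum + k₁.sum := by rw [hk₁, List.sum_append]
  have s2 : u.2.sum = q.2.sum + k₂.sum := by rw [hk₂, List.sum_append]
  have hq0 : 0 < q.1.sum := hq.2.1
  rcases Nat.eq_zero_or_pos k₁.sum with h0 | h0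
  · have n1 := eq_nil_of_sum_eq_zero hJ (fun a ha => hu.1.1.1 a (by rw [hk₁]; simp [ha])) h0
    have n2 := eq_nil_of_sum_eq_zero hJ (fun a ha => hu.1.1.2 a (by rw [hk₂]; simp [ha]))
      (by omega : k₂.sum = 0)
    rw [n1, List.append_nil] at hk₁
    rw [n2, List.append_nil] at hk₂
    exact (Prod.ext hk₁ hk₂).symm
  · refine absurd ?_ hu.2.2
    refine ⟨q, (k₁, k₂), e1, ?_, ?_, ?_, Prod.ext hk₁ hk₂⟩
    · change k₁.sum = k₂.sum
      omega
    · omega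
    · change k₁.sum < _
      omega

theorem injOn_pairAppend {J : Set ℕ} (hJ : 0 ∉ J) :
    Set.InjOn pairAppend (indecomposables J ×ˢ completions J [] []) := by
  rintro ⟨q, q'⟩ ⟨hq, -⟩ ⟨u, u'⟩ ⟨hu, -⟩ heq
  have heq₁ : q.1 ++ q'.1 = u.1 ++ u'.1 := congrArg Prod.fst heq
  have heq₂ : q.2 ++ q'.2 = u.2 ++ u'.2 := congrArg Prod.snd heq
  have hqu : q = u := by
    rcases le_total q.1.sum u.1.sum with hle | hle
    · exact eq_of_append_eq hJ hq hu heq₁ heq₂ hle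
    · exact (eq_of_append_eq hJ hu hq heq₁.symm heq₂.symm hle).symm
  subst hqu
  rw [Prod.ext (List.append_cancel_left heq₁) (List.append_cancel_left heq₂)]

theorem pairWeight_pairAppend {q q' : List ℕ × List ℕ} (h : q.1.sum = q.2.sum)
    (h' : q'.1.sum = q'.2.sum) : pairWeight (pairAppend (q, q')) = pairWeight q + pairWeight q' := by
  rw [pairWeight, pairWeight, pairWeight, ← expo_add, pairAppend, listIndex_append h h',
    List.sum_append]

theorem prefixSeries_nil_nil_eq_genFun (J : Set ℕ) :
    prefixSeries J [] [] = genFun (completions J [] []) pairWeight := rfl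

/-- Splitting off the indecomposable first summand is a bijection from nonempty pairs to products,
and both size and index are additive. -/
theorem genFun_indecomposables {J : Set ℕ} (hJ : 0 ∉ J) :
    prefixSeries J [] [] = 1 + genFun (indecomposables J) pairWeight * prefixSeries J [] [] := by
  conv_lhs => rw [prefixSeries_nil_nil hJ, nonempty_eq_image_pairAppend hJ,
    genFun_image _ (injOn_pairAppend hJ)]
  have hprod := genFun_prod (wt := pairWeight) (wt' := pairWeight)
    (finite_of_subset hJ (s := []) (t := []) (indecomposables_subset J))
    (finite_completions hJ [] [])
  rw [prefixSeries_nil_nil_eq_genFun, ← hprod]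
  congr 1
  refine genFun_congr ?_
  rintro ⟨q, q'⟩ ⟨hq, hq'⟩
  exact pairWeight_pairAppend hq.1.2 hq'.2

end Decomposition

/-! ### Counting meanders by pairs of lists; rescaling of parts -/

section Meanders

/-- The pair of lists of parts of a meander. -/
def Meander.pair {n : ℕ} (M : Meander n) : List ℕ × List ℕ := (M.top.blocks, M.bot.blocks)

theorem Meander.pair_injective {n : ℕ} : Function.Injective (Meander.pair (n := n)) := by
  intro M M' h
  exact Meander.ext (Composition.ext (congrArg Prod.fst h)) (Composition.ext (congrArg Prod.snd h))

theorem Meander.sum_pair {n : ℕ} (M : Meander n) : M.pair.1.sum = n ∧ M.pair.2.sum = n :=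
  ⟨M.top.blocks_sum, M.bot.blocks_sum⟩

theorem exists_pair_eq {J : Set ℕ} (hJ : 0 ∉ J) {n : ℕ} {p : List ℕ × List ℕ} (hp : PairIn J p)
    (h1 : p.1.sum = n) (h2 : p.2.sum = n) : ∃ M : Meander n, M.pair = p :=
  ⟨⟨⟨p.1, fun {a} ha => Nat.pos_of_ne_zero fun h0 => hJ (h0 ▸ hp.1 a ha), h1⟩,
    ⟨p.2, fun {a} ha => Nat.pos_of_ne_zero fun h0 => hJ (h0 ▸ hp.2 a ha), h2⟩⟩, rfl⟩

theorem Meander.indecomposable_iff {n : ℕ} (M : Meander n) :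
    M.Indecomposable ↔ 0 < n ∧ ¬ PairDecomposable M.pair := by
  refine and_congr_right fun _ => not_congr ?_
  have hpos : (0 : ℕ) ∉ {a : ℕ | 0 < a} := by simp
  constructor
  · rintro ⟨m₁, m₂, M₁, M₂, h1, h2, h3, h4⟩
    refine ⟨M₁.pair, M₂.pair, ?_, ?_, ?_, ?_, Prod.ext h3 h4⟩
    · rw [M₁.sum_pair.1, M₁.sum_pair.2]
    · rw [M₂.sum_pair.1, M₂.sum_pair.2]
    · rwa [M₁.sum_pair.1, M.sum_pair.1]
    · rwa [M₂.sum_pair.1, M.sum_pair.1]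
  · rintro ⟨q, q', h1, h2, h3, h4, h5⟩
    have hM : PairIn {a : ℕ | 0 < a} M.pair :=
      ⟨fun a ha => M.top.blocks_pos ha, fun a ha => M.bot.blocks_pos ha⟩
    rw [h5] at hM
    obtain ⟨hq, hq'⟩ := pairIn_append.1 hM
    obtain ⟨M₁, hM₁⟩ := exists_pair_eq hpos hq rfl h1.symm
    obtain ⟨M₂, hM₂⟩ := exists_pair_eq hpos hq' rfl h2.symm
    rw [M.sum_pair.1] at h3 h4
    rw [← hM₁, ← hM₂] at h5
    exact ⟨_, _, M₁, M₂, h3, h4, congrArg Prod.fst h5, congrArg Prod.snd h5⟩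

theorem ncard_meander {J : Set ℕ} (hJ : 0 ∉ J) {S : Set (List ℕ × List ℕ)}
    (hS : S ⊆ completions J [] []) {n k : ℕ} {T : Set (Meander n)}
    (hT : ∀ M, M ∈ T ↔ M.pair ∈ S ∧ M.index = k) :
    T.ncard = {p ∈ S | pairWeight p = expo n k}.ncard := by
  rw [← Set.InjOn.ncard_image (Meander.pair_injective (n := n)).injOn]
  congr 1
  ext p
  constructor
  · rintro ⟨M, hM, rfl⟩
    obtain ⟨h1, h2⟩ := (hT M).1 hM
    refine ⟨h1, ?_⟩
    rw [pairWeight, M.sum_pair.1, ← h2, index_eq_listIndex]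
    rfl
  · rintro ⟨hp, hw⟩
    rw [pairWeight, expo_eq_iff, expo_zero, expo_one] at hw
    obtain ⟨M, rfl⟩ := exists_pair_eq hJ (hS hp).1 hw.1 ((hS hp).2.symm.trans hw.1)
    refine ⟨M, (hT M).2 ⟨hp, ?_⟩, rfl⟩
    rw [index_eq_listIndex, ← hw.2]
    rfl

theorem partsIn_iff {J : Set ℕ} {n : ℕ} (M : Meander n) :
    M.PartsIn J ↔ M.pair ∈ completions J [] [] :=
  (and_iff_left (M.sum_pair.1.trans M.sum_pair.2.symm)).symm

theorem meanderCount_eq {J : Set ℕ} (hJ : 0 ∉ J) (n k : ℕ) :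
    meanderCount J n k = {p ∈ completions J [] [] | pairWeight p = expo n k}.ncard :=
  ncard_meander hJ subset_rfl fun M => and_congr_left' (partsIn_iff M)

theorem indecomposableCount_eq {J : Set ℕ} (hJ : 0 ∉ J) (n k : ℕ) :
    indecomposableCount J n k = {p ∈ indecomposables J | pairWeight p = expo n k}.ncard := by
  refine ncard_meander hJ (indecomposables_subset J) fun M => ?_
  simp only [Set.mem_ofPred_eq, indecomposables, partsIn_iff, M.indecomposable_iff, M.sum_pair.1]
  tauto

theorem expo_apply (e : Fin 2 →₀ ℕ) : expo (e 0) (e 1) = e := expo_eq_iff.2 ⟨rfl, rfl⟩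

theorem meanderSeries_eq {J : Set ℕ} (hJ : 0 ∉ J) : meanderSeries J = prefixSeries J [] [] := by
  ext e
  change (meanderCount J (e 0) (e 1) : ℚ) = _
  rw [meanderCount_eq hJ, expo_apply]
  rfl

theorem coeff_indecomposables {J : Set ℕ} (hJ : 0 ∉ J) (n k : ℕ) :
    coeff (expo n k) (genFun (indecomposables J) pairWeight) = indecomposableCount J n k := by
  rw [indecomposableCount_eq hJ]
  rfl

/-- Multiplication of all entries by `c`. -/
def scalePair (c : ℕ) (p : List ℕ × List ℕ) : List ℕ × List ℕ :=
  (p.1.map (c * ·), p.2.map (c * ·))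

theorem scalePair_injective {c : ℕ} (hc : 0 < c) : Function.Injective (scalePair c) := by
  have h : Function.Injective (List.map (c * ·)) :=
    List.map_injective_iff.2 fun a b hab => Nat.eq_of_mul_eq_mul_left hc hab
  intro p q hpq
  exact Prod.ext (h (congrArg Prod.fst hpq)) (h (congrArg Prod.snd hpq))

theorem sum_map_mul (c : ℕ) (l : List ℕ) : (l.map (c * ·)).sum = c * l.sum := by
  simpa using List.sum_map_mul_left l id c

theorem completions_scale {c : ℕ} (hc : 0 < c) :
    completions {c, 2 * c, 3 * c} [] [] = scalePair c '' completions {1, 2, 3} [] [] := by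
  have hl : ∀ l : List ℕ, (∀ a ∈ l, a ∈ ({c, 2 * c, 3 * c} : Set ℕ)) →
      ∃ l' : List ℕ, (∀ a ∈ l', a ∈ ({1, 2, 3} : Set ℕ)) ∧ l'.map (c * ·) = l := by
    intro l
    induction l with
    | nil => exact fun _ => ⟨[], by simp, rfl⟩
    | cons a l ih =>
      intro h
      obtain ⟨ha, hl⟩ := List.forall_mem_cons.1 h
      obtain ⟨l', hl', rfl⟩ := ih hl
      obtain ⟨b, hb, rfl⟩ : ∃ b ∈ ({1, 2, 3} : Set ℕ), c * b = a := by
        rcases ha with rfl | rfl | rfl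
        · exact ⟨1, by simp, by simp⟩
        · exact ⟨2, by simp, mul_comm _ _⟩
        · exact ⟨3, by simp, mul_comm _ _⟩
      exact ⟨b :: l', List.forall_mem_cons.2 ⟨hb, hl'⟩, rfl⟩
  have hl' : ∀ l : List ℕ, (∀ a ∈ l, a ∈ ({1, 2, 3} : Set ℕ)) →
      ∀ a ∈ l.map (c * ·), a ∈ ({c, 2 * c, 3 * c} : Set ℕ) := by
    intro l h a ha
    obtain ⟨b, hb, rfl⟩ := List.mem_map.1 ha
    rcases h b hb with rfl | rfl | rfl <;> simp [mul_comm]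
  ext ⟨l, m⟩
  constructor
  · rintro ⟨⟨h1, h2⟩, h3⟩
    obtain ⟨l, h1', rfl⟩ := hl l h1
    obtain ⟨m, h2', rfl⟩ := hl m h2
    refine ⟨(l, m), ⟨⟨h1', h2'⟩, ?_⟩, rfl⟩
    simp only [List.nil_append, sum_map_mul] at h3
    exact Nat.eq_of_mul_eq_mul_left hc h3
  · rintro ⟨⟨l, m⟩, ⟨⟨h1, h2⟩, h3⟩, h⟩
    cases h
    refine ⟨⟨hl' l h1, hl' m h2⟩, ?_⟩
    simp only [List.nil_append, sum_map_mul] at h3 ⊢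
    rw [h3]

theorem pairWeight_scalePair {c : ℕ} (hc : 0 < c) {p : List ℕ × List ℕ} (h : p.1.sum = p.2.sum) :
    pairWeight (scalePair c p) = c • pairWeight p := by
  rw [pairWeight, scalePair, sum_map_mul, listIndex_map_mul hc h, expo_eq_iff]
  simp [pairWeight, expo_zero, expo_one]

/-- Multiplying all parts by `c` is a bijection that multiplies both size and index by `c`, so only
exponents divisible by `c` occur. -/
theorem prefixSeries_scale {c : ℕ} (hc : c ≠ 0) :
    prefixSeries {c, 2 * c, 3 * c} [] [] = expand c hc (prefixSeries {1, 2, 3} [] []) := by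
  have hc' := Nat.pos_of_ne_zero hc
  have h : prefixSeries {c, 2 * c, 3 * c} [] [] =
      genFun (completions {1, 2, 3} [] []) fun p => c • pairWeight p := by
    rw [prefixSeries, completions_scale hc', genFun_image _ (scalePair_injective hc').injOn]
    exact genFun_congr fun p hp => pairWeight_scalePair hc' hp.2
  rw [h]
  ext e
  by_cases he : ∀ i, c ∣ e i
  · obtain ⟨d, rfl⟩ : ∃ d : Fin 2 →₀ ℕ, e = c • d := by
      choose d hd using he
      exact ⟨Finsupp.equivFunOnFinite.symm d, Finsupp.ext fun i => by simp [hd]⟩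
    rw [coeff_expand_smul, coeff_genFun, prefixSeries, coeff_genFun]
    congr 2
    ext p
    exact and_congr_right fun _ => smul_right_inj hc
  · push Not at he
    obtain ⟨i, hi⟩ := he
    rw [coeff_expand_of_not_dvd _ _ _ hi, coeff_genFun, Nat.cast_eq_zero]
    convert Set.ncard_empty (List ℕ × List ℕ)
    ext p
    simp only [Set.mem_ofPred_eq, Set.mem_empty_iff_false, iff_false, not_and]
    rintro - rfl
    exact hi ⟨_, rfl⟩

end Meanders

/-! ### The series of indecomposables -/

section Recurrence

/-- Combines `A = 1 + I A` with the equation for `A`, then cancels `A`, which is nonzero in a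
domain. -/
theorem indecomposables_equation {x y : MvPowerSeries (Fin 2) ℚ} (hx : x = X 0) (hy : y = X 1) :
    (1 - x - x ^ 2 * y - x ^ 3 * y) * (genFun (indecomposables {1, 2, 3}) pairWeight -
      (x * y + x ^ 2 * y ^ 2 + x ^ 3 * y ^ 3)) =
      2 * x ^ 2 * y + 4 * x ^ 3 * y + 2 * x ^ 3 * y ^ 2 + 2 * x ^ 4 * y ^ 2 + 2 * x ^ 5 * y := by
  have e1 := prefixSeries_equation hx hy
  have e2 := genFun_indecomposables zero_notMem_one_two_three
  have hA : prefixSeries {1, 2, 3} [] [] ≠ 0 := by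
    intro h
    rw [h] at e2
    simp at e2
  apply mul_left_cancel₀ hA
  linear_combination e1 - (1 - x - x ^ 2 * y - x ^ 3 * y) * e2

end Recurrence

end SeaweedMeander

end

/-! ### Extraction of coefficients -/

namespace SeaweedMeander

open MvPowerSeries

theorem coeff_expo_pow_mul_pow {n a : ℕ} (h : a < n) (k b : ℕ) :
    coeff (expo n k) ((X 0 : MvPowerSeries (Fin 2) ℚ) ^ a * X 1 ^ b) = 0 := by
  classical
  rw [← monomial_expo, coeff_monomial, if_neg]
  intro he
  rw [expo_eq_iff, expo_zero] at he
  omega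

theorem coeff_expo_mul (n k a b : ℕ) (φ : MvPowerSeries (Fin 2) ℚ) :
    coeff (expo (n + a) (k + b)) (X 0 ^ a * X 1 ^ b * φ) = coeff (expo n k) φ := by
  rw [← monomial_expo, add_comm n, add_comm k, expo_add, coeff_add_monomial_mul, one_mul]

theorem coeff_expo_mul_of_lt {k b : ℕ} (h : k < b) (n a : ℕ) (φ : MvPowerSeries (Fin 2) ℚ) :
    coeff (expo n k) (X 0 ^ a * X 1 ^ b * φ) = 0 := by
  rw [← monomial_expo, coeff_monomial_mul, if_neg]
  intro hle
  have := hle 1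
  rw [expo_one, expo_one] at this
  omega

/-- The fraction for `I` written as a fixed-point equation. All factors appear as `X 0 ^ a * X 1 ^
b`, exponents `0` and `1` included, so that the coefficient rules apply uniformly; the inhomogeneous
part has degree 6 in `X 0`, whence the bound on `n`. -/
theorem indecomposables_recurrence :
    genFun (indecomposables {1, 2, 3}) pairWeight =
      X 0 ^ 1 * X 1 ^ 0 * genFun (indecomposables {1, 2, 3}) pairWeight +
      X 0 ^ 2 * X 1 ^ 1 * genFun (indecomposables {1, 2, 3}) pairWeight +
      X 0 ^ 3 * X 1 ^ 1 * genFun (indecomposables {1, 2, 3}) pairWeight +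
      (X 0 ^ 1 * X 1 ^ 1 + X 0 ^ 2 * X 1 ^ 2 + X 0 ^ 3 * X 1 ^ 3 + X 0 ^ 2 * X 1 ^ 1 +
        4 • (X 0 ^ 3 * X 1 ^ 1) + X 0 ^ 4 * X 1 ^ 2 + 2 • (X 0 ^ 5 * X 1 ^ 1) -
        2 • (X 0 ^ 4 * X 1 ^ 3) - X 0 ^ 5 * X 1 ^ 4 - X 0 ^ 5 * X 1 ^ 3 - X 0 ^ 6 * X 1 ^ 4) := by
  have h := indecomposables_equation rfl rfl
  simp only [nsmul_eq_mul, Nat.cast_ofNat]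
  linear_combination h

theorem coeff_indecomposables_recurrence {n : ℕ} (hn : 6 < n) (k : ℕ) :
    coeff (expo n k) (genFun (indecomposables {1, 2, 3}) pairWeight) =
      coeff (expo n k) (X 0 ^ 1 * X 1 ^ 0 * genFun (indecomposables {1, 2, 3}) pairWeight) +
      coeff (expo n k) (X 0 ^ 2 * X 1 ^ 1 * genFun (indecomposables {1, 2, 3}) pairWeight) +
      coeff (expo n k) (X 0 ^ 3 * X 1 ^ 1 * genFun (indecomposables {1, 2, 3}) pairWeight) := by
  conv_lhs => rw [indecomposables_recurrence]
  have h0 : ∀ a b, a ≤ 6 →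
      coeff (expo n k) ((X 0 : MvPowerSeries (Fin 2) ℚ) ^ a * X 1 ^ b) = 0 :=
    fun a b ha => coeff_expo_pow_mul_pow (by omega) k b
  simp only [map_add, map_sub, map_nsmul]
  rw [h0 1 1, h0 2 2, h0 3 3, h0 2 1, h0 3 1, h0 4 2, h0 5 1, h0 4 3, h0 5 4, h0 5 3, h0 6 4] <;>
    norm_num

end SeaweedMeander

theorem mainTheorem10 :
    (∀ x y : MvPowerSeries (Fin 2) ℚ, x = MvPowerSeries.X 0 → y = MvPowerSeries.X 1 →
      SeaweedMeander.meanderSeries {1, 2, 3} =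
        (1 - x - x ^ 2 * y - x ^ 3 * y) *
          ((1 - x - x ^ 2 * y - x ^ 3 * y) * (1 - x * y - x ^ 2 * y ^ 2 - x ^ 3 * y ^ 3) -
            (2 * x ^ 2 * y + 4 * x ^ 3 * y + 2 * x ^ 3 * y ^ 2 + 2 * x ^ 4 * y ^ 2 +
              2 * x ^ 5 * y))⁻¹) ∧
    (∀ n : ℕ, 6 < n →
      SeaweedMeander.indecomposableCount {1, 2, 3} n 0 =
          SeaweedMeander.indecomposableCount {1, 2, 3} (n - 1) 0 ∧
      ∀ k : ℕ, 1 ≤ k →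
        SeaweedMeander.indecomposableCount {1, 2, 3} n k =
          SeaweedMeander.indecomposableCount {1, 2, 3} (n - 1) k +
          SeaweedMeander.indecomposableCount {1, 2, 3} (n - 2) (k - 1) +
          SeaweedMeander.indecomposableCount {1, 2, 3} (n - 3) (k - 1)) ∧
    (∀ c : ℕ, 1 ≤ c →
      SeaweedMeander.meanderSeries {c, 2 * c, 3 * c} =
        MvPowerSeries.subst
          (fun i : Fin 2 => (MvPowerSeries.X i : MvPowerSeries (Fin 2) ℚ) ^ c)
          (SeaweedMeander.meanderSeries {1, 2, 3})) := by
  have h0 := SeaweedMeander.zero_notMem_one_two_three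
  refine ⟨fun x y hx hy => ?_, fun n hn => ⟨?_, fun k hk => ?_⟩, fun c hc => ?_⟩
  · rw [SeaweedMeander.meanderSeries_eq h0, MvPowerSeries.eq_mul_inv_iff_mul_eq]
    · exact SeaweedMeander.prefixSeries_equation hx hy
    · subst hx hy
      simp
  · obtain ⟨m, rfl⟩ : ∃ m, n = m + 1 := ⟨n - 1, by omega⟩
    have h := SeaweedMeander.coeff_indecomposables_recurrence hn 0
    have h1 := SeaweedMeander.coeff_expo_mul m 0 1 0
      (SeaweedMeander.genFun (SeaweedMeander.indecomposables {1, 2, 3}) SeaweedMeander.pairWeight)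
    rw [add_zero] at h1
    -- For `k = 0` the two terms carrying a factor `X 1` vanish, in accordance with the convention
    -- for negative index.
    rw [h1, SeaweedMeander.coeff_expo_mul_of_lt one_pos, SeaweedMeander.coeff_expo_mul_of_lt one_pos,
      add_zero, add_zero, SeaweedMeander.coeff_indecomposables h0,
      SeaweedMeander.coeff_indecomposables h0] at h
    exact_mod_cast h
  · obtain ⟨m, rfl⟩ : ∃ m, n = m + 3 := ⟨n - 3, by omega⟩
    obtain ⟨j, rfl⟩ : ∃ j, k = j + 1 := ⟨k - 1, by omega⟩
    have h := SeaweedMeander.coeff_indecomposables_recurrence hn (j + 1)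
    have h1 := SeaweedMeander.coeff_expo_mul (m + 2) (j + 1) 1 0
      (SeaweedMeander.genFun (SeaweedMeander.indecomposables {1, 2, 3}) SeaweedMeander.pairWeight)
    have h2 := SeaweedMeander.coeff_expo_mul (m + 1) j 2 1
      (SeaweedMeander.genFun (SeaweedMeander.indecomposables {1, 2, 3}) SeaweedMeander.pairWeight)
    have h3 := SeaweedMeander.coeff_expo_mul m j 3 1
      (SeaweedMeander.genFun (SeaweedMeander.indecomposables {1, 2, 3}) SeaweedMeander.pairWeight)
    rw [add_zero] at h1
    rw [h1, h2, h3] at h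
    simp only [SeaweedMeander.coeff_indecomposables h0] at h
    exact_mod_cast h
  · have hc0 : c ≠ 0 := by omega
    rw [SeaweedMeander.meanderSeries_eq h0,
      SeaweedMeander.meanderSeries_eq (by simp; omega), SeaweedMeander.prefixSeries_scale hc0,
      MvPowerSeries.expand, MvPowerSeries.coe_substAlgHom]
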